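/- Let $G=(V,E)$ be a finite directed acyclic graph (parallel edges allowed). For an edge $e$ write $t(e)$ for its tail and $h(e)$ for its head; a source (sink) is a vertex with no incoming (outgoing) edges, and the other vertices are internal. Let $\mathbf a\in\mathbb Z^V$ be a conservationist netflow vector: $\mathbf a_i=1$ for each source $i$, $\mathbf a_i<0$ for each sink $i$, and $\mathbf a_i=0$ for each internal vertex $i$. Let $\mathcal F$ be a framing of $(G,\mathbf a)$: a total order on the outgoing edges of each non-sink vertex, a total order on the incoming edges of each internal vertex, and a total order $<_{\mathrm{src}}$ on the sources. For real $x$, an $x\times\mathbf a$-flow is a function $F:E\to\mathbb R_{\ge 0}$ such that $\sum_{t(e)=i}F(e)-\sum_{h(e)=i}F(e)=x\,\mathbf a_i$ for all $i\in V$. A route is a path from a source to a sink; its indicator vector $\mathcal I(p)\in\mathbb R^E$ has entry $1$ at the edges of $p$ and $0$ elsewhere. For distinct paths $p,q$ from a vertex $i$ to sinks, with maximal common initial subpath $\sigma$, write $p<_i^+q$ if the edge of $p$ following $\sigma$ precedes the edge of $q$ following $\sigma$ in the order on the outgoing edges of the last vertex of $\sigma$ (which is $i$ if $\sigma$ has no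 edges). Dually, for $i$ not a sink and distinct paths $p,q$ from sources to $i$, with maximal common final subpath $\sigma$, write $p<_i^-q$ if the edge of $p$ preceding $\sigma$ precedes the edge of $q$ preceding $\sigma$ in the order on the incoming edges of the first vertex of $\sigma$. Two routes $p,q$ through a common vertex $i$ are incompatible at $i$ if, up to exchanging $p$ and $q$, the part of $p$ before $i$ is $<_i^-$ that of $q$ while the part of $q$ after $i$ is $<_i^+$ that of $p$; routes are compatible if they are not incompatible at any common vertex. A route-clique is a set of pairwise compatible routes. A layering is a set $L$ of routes containing exactly one route $L_i$ beginning at each source $i$, and exactly $|\mathbf a_j|$ routes ending at each sink $j$. Put $\mathcal J(L)=\sum_{p\in L}\mathcal I(p)$. For distinct layerings $L,M$ write $L<_{\mathrm{src}}^+M$ if $L_i<_i^+M_i$, where $i$ is the $<_{\mathrm{src}}$-maximal source with $L_i\ne M_i$; this is a total order on layerings. For a set $\mathcal L$ of layerings let $\mathrm{routes}(\mathcal L)=\bigcup_{L\in\mathcal L}L$. A set $\mathcal L=\{L^1<_{\mathrm{src}}^+\dots<_{\mathrm{src}}^+L^m\}$ of layerings ($m\ge 0$) is a layering-simplex if 1.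 $\mathrm{routes}(\mathcal L)$ is a route-clique; 2. for every $i\in[m]$, $L^i$ is the $<_{\mathrm{src}}^+$-minimum of the layerings $L$ with $L\subseteq\mathrm{routes}(\{L^i,\dots,L^m\})$; 3. for every $i\in[m]$, some route of $L^i$ is not in $\mathrm{routes}(\{L^{i+1},\dots,L^m\})$. **Theorem.** Let $x>0$ and let $F$ be an $x\times\mathbf a$-flow of $G$. Then there is exactly one pair consisting of a layering-simplex $\mathcal L$ and positive real coefficients $(a_L)_{L\in\mathcal L}$ such that $$F=\sum_{L\in\mathcal L}a_L\,\mathcal J(L).$$ Moreover, if $F$ is integer-valued, then all the coefficients $a_L$ are integers. -/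

import Mathlib

/-- A directed graph with vertices `V` and edges `E`; parallel edges are allowed. -/
structure DiMultigraph (V E : Type*) where
  tail : E → V
  head : E → V

namespace DiMultigraph

variable {V E : Type*}

/-- `G` has no oriented cycle (a directed acyclic graph). -/
def IsAcyclic (G : DiMultigraph V E) : Prop :=
  ∀ v, ¬ Relation.TransGen (fun u w => ∃ e, G.tail e = u ∧ G.head e = w) v v

/-- A source is a vertex with no incoming edges. -/
def IsSource (G : DiMultigraph V E) (v : V) : Prop := ∀ e, G.head e ≠ v

/-- A sink is a vertex with no outgoing edges. -/
def IsSink (G : DiMultigraph V E) (v : V) : Prop := ∀ e, G.tail e ≠ v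

/-- An internal vertex is one that is neither a source nor a sink. -/
def IsInternal (G : DiMultigraph V E) (v : V) : Prop := ¬ G.IsSource v ∧ ¬ G.IsSink v

/-- `F` is a nonnegative flow on `G` with (real) netflow vector `b`. -/
def IsFlow [Fintype E] [DecidableEq V] (G : DiMultigraph V E) (b : V → ℝ) (F : E → ℝ) : Prop :=
  (∀ e, 0 ≤ F e) ∧
    ∀ v, (∑ e with G.tail e = v, F e) - (∑ e with G.head e = v, F e) = b v

/-- A conservationist netflow vector: `1` at sources, negative at sinks, `0` at internal vertices. -/
structure IsConservationist (G : DiMultigraph V E) (a : V → ℤ) : Prop where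
  source : ∀ v, G.IsSource v → a v = 1
  sink : ∀ v, G.IsSink v → a v < 0
  internal : ∀ v, G.IsInternal v → a v = 0

/-- A framing: strict total orders on the outgoing edges of each non-sink vertex, on the incoming
edges of each internal vertex, and on the set of sources. (The values of the relations elsewhere
are irrelevant.) -/
structure Framing (G : DiMultigraph V E) where
  outLt : V → E → E → Prop
  inLt : V → E → E → Prop
  srcLt : V → V → Prop
  outLt_total : ∀ v, ¬ G.IsSink v →
    IsStrictTotalOrder {e : E // G.tail e = v} (fun e f => outLt v e f)
  inLt_total : ∀ v, G.IsInternal v →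
    IsStrictTotalOrder {e : E // G.head e = v} (fun e f => inLt v e f)
  srcLt_total : IsStrictTotalOrder {v : V // G.IsSource v} (fun v w => srcLt v w)

/-- `G.IsPath u l w`: the list of edges `l` is a directed path from `u` to `w`. -/
inductive IsPath (G : DiMultigraph V E) : V → List E → V → Prop
  | nil (v : V) : IsPath G v [] v
  | cons (e : E) {l : List E} {w : V} (h : IsPath G (G.head e) l w) : IsPath G (G.tail e) (e :: l) w

/-- A route is a path from a source to a sink. -/
@[ext]
structure Route (G : DiMultigraph V E) where
  src : V
  edges : List E
  snk : V
  isPath : G.IsPath src edges snk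
  isSource : G.IsSource src
  isSink : G.IsSink snk

open Classical in
/-- The indicator vector of a route. -/
noncomputable def Route.indicator {G : DiMultigraph V E} (p : G.Route) : E → ℝ :=
  fun e => if e ∈ p.edges then 1 else 0

/-- The indicator vector of a finite set of routes. -/
noncomputable def layeringIndicator {G : DiMultigraph V E} (L : Finset G.Route) : E → ℝ :=
  ∑ p ∈ L, p.indicator

open Classical in
/-- A layering: a set of routes, exactly one of which begins at each source `i`, and exactly
`|a j|` of which end at each sink `j`. -/
structure IsLayering (G : DiMultigraph V E) (a : V → ℤ) (L : Finset G.Route) : Prop where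
  source : ∀ i, G.IsSource i → (L.filter fun p => p.src = i).card = 1
  sink : ∀ j, G.IsSink j → ((L.filter fun p => p.snk = j).card : ℤ) = |a j|

/-- The set of routes used by the members of a family of layerings. -/
def routesOf {G : DiMultigraph V E} (𝓛 : Set (Finset G.Route)) : Set G.Route :=
  {p | ∃ L ∈ 𝓛, p ∈ L}

namespace Framing

variable {G : DiMultigraph V E} (𝓕 : G.Framing)

/-- The post-order on paths (edge lists) that leave a common vertex and end in sinks: after the
maximal common initial subpath `σ`, the paths continue by `f` and `g` with `f` below `g` in the
order of outgoing edges. (As that order is irreflexive, `f ≠ g`, so `σ` is indeed maximal.) -/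
def PostLt (p q : List E) : Prop :=
  ∃ (σ p' q' : List E) (f g : E),
    p = σ ++ f :: p' ∧ q = σ ++ g :: q' ∧ 𝓕.outLt (G.tail f) f g

/-- The pre-order on paths (edge lists) that start in sources and end in a common non-sink vertex,
dual to `PostLt`. -/
def PreLt (p q : List E) : Prop :=
  ∃ (σ p' q' : List E) (f g : E),
    p = p' ++ f :: σ ∧ q = q' ++ g :: σ ∧ 𝓕.inLt (G.head f) f g

/-- `p` and `q` both pass through `i`, with `p` before `q` in the pre-`i` order and `q` before `p`
in the post-`i` order. -/
def CrossAt (i : V) (p q : G.Route) : Prop :=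
  ∃ p₁ p₂ q₁ q₂ : List E,
    p.edges = p₁ ++ p₂ ∧ G.IsPath p.src p₁ i ∧ G.IsPath i p₂ p.snk ∧
    q.edges = q₁ ++ q₂ ∧ G.IsPath q.src q₁ i ∧ G.IsPath i q₂ q.snk ∧
    𝓕.PreLt p₁ q₁ ∧ 𝓕.PostLt q₂ p₂

/-- Two routes are compatible if they are not incompatible at any shared vertex. -/
def Compatible (p q : G.Route) : Prop :=
  ∀ i, ¬ 𝓕.CrossAt i p q ∧ ¬ 𝓕.CrossAt i q p

/-- A route-clique is a set of pairwise compatible routes. -/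
def IsRouteClique (R : Set G.Route) : Prop := R.Pairwise 𝓕.Compatible

/-- The post-source order on layerings: at the maximal source where the routes of `L` and `M`
differ, the route `p` of `L` is below the route `q` of `M` in the post-order. -/
def LayeringLt (L M : Finset G.Route) : Prop :=
  ∃ p ∈ L, ∃ q ∈ M, p.src = q.src ∧ 𝓕.PostLt p.edges q.edges ∧
    ∀ p' ∈ L, ∀ q' ∈ M, p'.src = q'.src → 𝓕.srcLt p.src p'.src → p' = q'

/-- A layering-simplex. If `𝓛 = {L¹ < ⋯ < Lᵐ}` in the post-source order and `L = Lⁱ`, then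
`{K ∈ 𝓛 | K = L ∨ L < K}` is `{Lⁱ, …, Lᵐ}` and `{K ∈ 𝓛 | L < K}` is `{Lⁱ⁺¹, …, Lᵐ}`. -/
structure IsLayeringSimplex (a : V → ℤ) (𝓛 : Finset (Finset G.Route)) : Prop where
  isLayering : ∀ L ∈ 𝓛, G.IsLayering a L
  clique : 𝓕.IsRouteClique (routesOf (𝓛 : Set (Finset G.Route)))
  isMin : ∀ L ∈ 𝓛, ∀ M : Finset G.Route, G.IsLayering a M →
    (M : Set G.Route) ⊆ routesOf {K | K ∈ 𝓛 ∧ (K = L ∨ 𝓕.LayeringLt L K)} →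
    L = M ∨ 𝓕.LayeringLt L M
  exists_new : ∀ L ∈ 𝓛, ∃ p ∈ L, p ∉ routesOf {K | K ∈ 𝓛 ∧ 𝓕.LayeringLt L K}

/-- `F = ∑_{L ∈ 𝓛} c_L J(L)` is a positive layering-simplex combination
(only the values of `c` on `𝓛` matter). -/
structure IsPositiveCombination (a : V → ℤ) (F : E → ℝ)
    (𝓛 : Finset (Finset G.Route)) (c : Finset G.Route → ℝ) : Prop where
  simplex : 𝓕.IsLayeringSimplex a 𝓛
  pos : ∀ L ∈ 𝓛, 0 < c L
  eq_sum : F = ∑ L ∈ 𝓛, c L • layeringIndicator L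

end Framing

end DiMultigraph

/-! The proof has two layers: a flow determines weights on routes, and the weights determine a
layering-simplex.

Routes. Picture `F e` as the width of an interval. At an internal vertex, stack the incoming
intervals in framing order, and likewise the outgoing ones. By conservation both stacks have the
same height, so gluing them carries each point of an edge to the next edge. The points that follow a
given route form an interval of length `pathWeight`. These intervals tile every edge, so the weights
sum to `F` (`sum_pathWeight_mul_indicator`). Gluing preserves order, so two routes that cross cannot
both have positive width (`isRouteClique_support_pathWeight`). Conversely, suppose nonnegative
weights on a clique sum to `F`. Compatibility makes an initial part of the incoming stack and an
initial part of the outgoing stack nested as sets of routes, so the mass of their intersection is a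
minimum. This is the gluing rule `step`, and by induction along paths the weights must equal
`pathWeight` (`eq_pathWeight_of_isRouteClique`).

Layerings. Such weights have mass `x` at each source and `x * |a j|` at each sink `j`. If `x > 0`,
Hall's marriage theorem gives a layering inside the support. Subtract the least such layering as
often as its lightest route allows: that route leaves the support, the rest is again balanced, and
recursion yields the simplex (`exists_layeringSimplex`). No choice was made: in any simplex the
least layering is the least one in the support, and its coefficient is the smallest weight on it
(`layeringSimplex_unique`).

Integrality survives because only sums, differences and minima of flow values occur. -/

namespace Finset

/-! ### Finite total orders and stacked intervals -/

/-- A nonempty finite set with a transitive, total relation has a greatest element. -/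
theorem exists_greatest_of_total {α : Type*} {S : Finset α} {r : α → α → Prop}
    (htrans : ∀ a ∈ S, ∀ b ∈ S, ∀ c ∈ S, r a b → r b c → r a c)
    (htotal : ∀ a ∈ S, ∀ b ∈ S, a ≠ b → r a b ∨ r b a) (hS : S.Nonempty) :
    ∃ m ∈ S, ∀ b ∈ S, b = m ∨ r b m := by
  classical
  induction hS using Finset.Nonempty.cons_induction with
  | singleton a => exact ⟨a, by simp, by simp⟩
  | cons a s ha hs ih =>
    obtain ⟨m, hm, hmax⟩ := ih
      (fun x hx y hy z hz => htrans x (by simp [hx]) y (by simp [hy]) z (by simp [hz]))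
      (fun x hx y hy => htotal x (by simp [hx]) y (by simp [hy]))
    have ham : a ≠ m := fun h => ha (h ▸ hm)
    rcases htotal a (by simp) m (by simp [hm]) ham with h | h
    · refine ⟨m, by simp [hm], fun b hb => ?_⟩
      rcases Finset.mem_cons.1 hb with rfl | hb
      · exact Or.inr h
      · exact hmax b hb
    · refine ⟨a, by simp, fun b hb => ?_⟩
      rcases Finset.mem_cons.1 hb with rfl | hb
      · exact Or.inl rfl
      · rcases hmax b hb with rfl | h'
        · exact Or.inr h
        · exact Or.inr (htrans b (by simp [hb]) m (by simp [hm]) a (by simp) h' h)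

open Classical in
/-- Stacking intervals of lengths `F` in the order `r` tiles the interval of length `∑ F`. -/
theorem sum_stack_telescope {α : Type*} {S : Finset α} {r : α → α → Prop} (F : α → ℝ)
    (χ : ℝ → ℝ) (hirr : ∀ a ∈ S, ¬ r a a)
    (htrans : ∀ a ∈ S, ∀ b ∈ S, ∀ c ∈ S, r a b → r b c → r a c)
    (htotal : ∀ a ∈ S, ∀ b ∈ S, a ≠ b → r a b ∨ r b a) :
    ∑ e ∈ S, (χ ((∑ f ∈ S with r f e, F f) + F e) - χ (∑ f ∈ S with r f e, F f)) =
      χ (∑ e ∈ S, F e) - χ 0 := by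
  induction hn : S.card generalizing S with
  | zero => simp [Finset.card_eq_zero.1 hn]
  | succ n ih =>
    -- The greatest element carries the top interval, so removing it changes no other base.
    obtain ⟨m, hm, hmax⟩ := exists_greatest_of_total htrans htotal
      (Finset.card_pos.1 (by omega))
    have hlow : S.filter (fun f => r f m) = S.erase m := by
      ext b
      simp only [Finset.mem_filter, Finset.mem_erase]
      constructor
      · rintro ⟨hb, hr⟩
        exact ⟨fun h => hirr m hm (h ▸ hr), hb⟩
      · rintro ⟨hne, hb⟩
        exact ⟨hb, (hmax b hb).resolve_left hne⟩
    have hrest : ∀ e ∈ S.erase m,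
        (S.filter fun f => r f e) = (S.erase m).filter fun f => r f e := by
      intro e he
      obtain ⟨hne, heS⟩ := Finset.mem_erase.1 he
      ext b
      simp only [Finset.mem_filter, Finset.mem_erase]
      constructor
      · rintro ⟨hb, hr⟩
        refine ⟨⟨fun h => ?_, hb⟩, hr⟩
        subst h
        exact hirr e heS (htrans e heS b hm e heS ((hmax e heS).resolve_left hne) hr)
      · rintro ⟨⟨-, hb⟩, hr⟩
        exact ⟨hb, hr⟩
    have hsub : S.erase m ⊆ S := Finset.erase_subset _ _
    have := ih (S := S.erase m) (fun a ha => hirr a (hsub ha))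
      (fun a ha b hb c hc => htrans a (hsub ha) b (hsub hb) c (hsub hc))
      (fun a ha b hb => htotal a (hsub ha) b (hsub hb))
      (by rw [Finset.card_erase_of_mem hm]; omega)
    rw [← Finset.sum_erase_add _ _ hm, hlow, Finset.sum_congr rfl
      (fun e he => by rw [hrest e he]), this, Finset.sum_erase_add _ _ hm]
    ring

end Finset

/-! ### Paths and routes in an acyclic graph -/

namespace DiMultigraph

variable {V E : Type*} {G : DiMultigraph V E}

theorem isPath_nil_iff {u w : V} : G.IsPath u [] w ↔ u = w :=
  ⟨fun h => by cases h; rfl, fun h => h ▸ .nil u⟩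

theorem isPath_cons_iff {u w : V} {e : E} {l : List E} :
    G.IsPath u (e :: l) w ↔ G.tail e = u ∧ G.IsPath (G.head e) l w :=
  ⟨fun h => by cases h with | cons e h => exact ⟨rfl, h⟩, fun ⟨h, h'⟩ => h ▸ .cons e h'⟩

theorem isPath_append_iff {u w : V} {l l' : List E} :
    G.IsPath u (l ++ l') w ↔ ∃ v, G.IsPath u l v ∧ G.IsPath v l' w := by
  induction l generalizing u with
  | nil => simp [isPath_nil_iff]
  | cons e l ih => simp [isPath_cons_iff, ih, and_assoc]

theorem isPath_snoc_iff {u w : V} {e : E} {l : List E} :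
    G.IsPath u (l ++ [e]) w ↔ G.IsPath u l (G.tail e) ∧ G.head e = w := by
  simp [isPath_append_iff, isPath_cons_iff, isPath_nil_iff]

theorem isPath_append_cons_iff {u w : V} {e : E} {l l' : List E} :
    G.IsPath u (l ++ e :: l') w ↔ G.IsPath u l (G.tail e) ∧ G.IsPath (G.head e) l' w := by
  simp [isPath_append_iff, isPath_cons_iff]

theorem IsPath.transGen {u w : V} {l : List E} (h : G.IsPath u l w) (hl : l ≠ []) :
    Relation.TransGen (fun u w => ∃ e, G.tail e = u ∧ G.head e = w) u w := by
  induction h with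
  | nil v => exact absurd rfl hl
  | cons e h ih =>
    rename_i l w
    cases l with
    | nil =>
      cases isPath_nil_iff.1 h
      exact .single ⟨e, rfl, rfl⟩
    | cons f l => exact .head ⟨e, rfl, rfl⟩ (ih (by simp))

theorem IsAcyclic.eq_nil_of_isPath (hG : G.IsAcyclic) {v : V} {l : List E}
    (h : G.IsPath v l v) : l = [] := by
  by_contra hl
  exact hG v (h.transGen hl)

theorem IsAcyclic.nodup_of_isPath (hG : G.IsAcyclic) {u w : V} {l : List E}
    (h : G.IsPath u l w) : l.Nodup := by
  induction h with
  | nil v => exact List.nodup_nil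
  | cons e h ih =>
    refine List.nodup_cons.2 ⟨fun he => ?_, ih⟩
    obtain ⟨l₁, l₂, rfl⟩ := List.append_of_mem he
    have h1 := (isPath_append_cons_iff.1 h).1
    have := hG.eq_nil_of_isPath (isPath_cons_iff.2 ⟨rfl, h1⟩ : G.IsPath (G.tail e) (e :: l₁) _)
    simp at this

theorem IsSource.eq_nil_of_isPath {v : V} (hv : G.IsSource v) {u : V} {l : List E}
    (h : G.IsPath u l v) : l = [] := by
  rcases List.eq_nil_or_concat l with rfl | ⟨l, e, rfl⟩
  · rfl
  · rw [List.concat_eq_append, isPath_snoc_iff] at h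
    exact absurd h.2 (hv e)

theorem IsSink.eq_nil_of_isPath {v : V} (hv : G.IsSink v) {w : V} {l : List E}
    (h : G.IsPath v l w) : l = [] := by
  cases l with
  | nil => rfl
  | cons e l => exact absurd (isPath_cons_iff.1 h).1 (hv e)

/-- Acyclicity forbids repeated edges, which bounds the length of a path by the number of edges. -/
theorem finite_setOf_isPath [Finite E] (hG : G.IsAcyclic) :
    {l : List E | ∃ u w, G.IsPath u l w}.Finite := by
  classical
  have := Fintype.ofFinite E
  refine (List.finite_length_le E (Fintype.card E)).subset ?_
  rintro l ⟨u, w, h⟩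
  exact (hG.nodup_of_isPath h).length_le_card

theorem not_isSink_tail (e : E) : ¬ G.IsSink (G.tail e) := fun h => h e rfl

theorem not_isSource_head (e : E) : ¬ G.IsSource (G.head e) := fun h => h e rfl

theorem isInternal_of_head_eq_tail {e f : E} (h : G.head e = G.tail f) :
    G.IsInternal (G.head e) :=
  ⟨not_isSource_head e, h ▸ not_isSink_tail f⟩

namespace Route

theorem edges_injective_of_ne_nil {p q : G.Route} (hp : p.edges ≠ []) (h : p.edges = q.edges) :
    p = q := by
  have h1 := p.isPath
  have h2 := q.isPath
  rw [← h] at h2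
  obtain ⟨e, l, hl⟩ := List.exists_cons_of_ne_nil hp
  have hsrc : p.src = q.src := by
    rw [hl] at h1 h2
    rw [← (isPath_cons_iff.1 h1).1, (isPath_cons_iff.1 h2).1]
  obtain ⟨l, e, hl⟩ := (List.eq_nil_or_concat p.edges).resolve_left hp
  have hsnk : p.snk = q.snk := by
    rw [hl, List.concat_eq_append] at h1 h2
    rw [← (isPath_snoc_iff.1 h1).2, (isPath_snoc_iff.1 h2).2]
  exact Route.ext hsrc h hsnk

/-- An empty route would be a vertex that is both source and sink, where the netflow would be `1`
and negative at once. -/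
theorem edges_ne_nil {a : V → ℤ} (ha : G.IsConservationist a) (p : G.Route) : p.edges ≠ [] := by
  intro h
  have := p.isPath
  rw [h, isPath_nil_iff] at this
  have h1 := ha.source _ p.isSource
  have h2 := ha.sink _ p.isSink
  rw [← this] at h2
  omega

theorem edges_injective {a : V → ℤ} (ha : G.IsConservationist a) :
    Function.Injective (Route.edges : G.Route → List E) :=
  fun p _ h => edges_injective_of_ne_nil (p.edges_ne_nil ha) h

theorem finite [Finite E] (hG : G.IsAcyclic) {a : V → ℤ} (ha : G.IsConservationist a) :
    Finite G.Route := by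
  have : Finite {l : List E | ∃ u w, G.IsPath u l w} := (finite_setOf_isPath hG).to_subtype
  refine Finite.of_injective
    (fun p : G.Route => (⟨p.edges, _, _, p.isPath⟩ : {l : List E | ∃ u w, G.IsPath u l w})) ?_
  intro p q h
  exact edges_injective ha (congrArg Subtype.val h)

theorem append_cons_inj (hG : G.IsAcyclic) (p : G.Route) {l₁ l₂ l₁' l₂' : List E} {e : E}
    (h : p.edges = l₁ ++ e :: l₂) (h' : p.edges = l₁' ++ e :: l₂') : l₁ = l₁' ∧ l₂ = l₂' := by
  have hn := hG.nodup_of_isPath p.isPath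
  rw [h] at hn h'
  have h1 : e ∉ l₁ := by
    intro he
    have := List.nodup_append.1 hn
    exact this.2.2 e he e (by simp) rfl
  have hn' := hn
  rw [h'] at hn'
  have h2 : e ∉ l₁' := by
    intro he
    have := List.nodup_append.1 hn'
    exact this.2.2 e he e (by simp) rfl
  rw [List.append_eq_append_iff] at h'
  rcases h' with ⟨c, rfl, hc⟩ | ⟨c, rfl, hc⟩
  · cases c with
    | nil => simpa using hc
    | cons x c =>
      simp only [List.cons_append, List.cons.injEq] at hc
      exact absurd (by simp [hc.1]) h2
  · cases c with
    | nil => simpa using hc.symm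
    | cons x c =>
      simp only [List.cons_append, List.cons.injEq] at hc
      exact absurd (by simp [hc.1]) h1

/-- A route has at most one edge with a given tail. -/
theorem eq_of_tail_eq (hG : G.IsAcyclic) (p : G.Route) {e f : E} (he : e ∈ p.edges)
    (hf : f ∈ p.edges) (h : G.tail e = G.tail f) : e = f := by
  obtain ⟨l₁, l₂, hl⟩ := List.append_of_mem he
  have hp := p.isPath
  rw [hl] at hp hf
  obtain ⟨h1, h2⟩ := isPath_append_cons_iff.1 hp
  rcases List.mem_append.1 hf with hf | hf
  · obtain ⟨m₁, m₂, rfl⟩ := List.append_of_mem hf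
    have := (isPath_append_iff.1 h1)
    obtain ⟨v, h3, h4⟩ := this
    obtain rfl : G.tail f = v := (isPath_cons_iff.1 h4).1
    rw [h] at h4
    simpa using hG.eq_nil_of_isPath h4
  · rcases List.mem_cons.1 hf with rfl | hf
    · rfl
    · obtain ⟨m₁, m₂, rfl⟩ := List.append_of_mem hf
      have := (isPath_append_cons_iff.1 h2).1
      have := hG.eq_nil_of_isPath (isPath_cons_iff.2 ⟨h, this⟩ : G.IsPath (G.tail f) (e :: m₁) _)
      simp at this

/-- A route has at most one edge with a given head. -/
theorem eq_of_head_eq (hG : G.IsAcyclic) (p : G.Route) {e f : E} (he : e ∈ p.edges)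
    (hf : f ∈ p.edges) (h : G.head e = G.head f) : e = f := by
  obtain ⟨l₁, l₂, hl⟩ := List.append_of_mem he
  have hp := p.isPath
  rw [hl] at hp hf
  obtain ⟨h1, h2⟩ := isPath_append_cons_iff.1 hp
  rcases List.mem_append.1 hf with hf | hf
  · obtain ⟨m₁, m₂, rfl⟩ := List.append_of_mem hf
    have := (isPath_append_cons_iff.1 h1).2
    have := hG.eq_nil_of_isPath (isPath_snoc_iff.2 ⟨this, h⟩)
    simp at this
  · rcases List.mem_cons.1 hf with rfl | hf
    · rfl
    · obtain ⟨m₁, m₂, rfl⟩ := List.append_of_mem hf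
      have := (isPath_append_cons_iff.1 h2).1
      have := hG.eq_nil_of_isPath (isPath_snoc_iff.2 ⟨this, h.symm⟩)
      simp at this

end Route

theorem Route.exists_split_at (p : G.Route) {e : E} (he : e ∈ p.edges) :
    ∃ l₁ l₂, p.edges = l₁ ++ e :: l₂ ∧ G.IsPath p.src l₁ (G.tail e) ∧
      G.IsPath (G.head e) l₂ p.snk := by
  obtain ⟨l₁, l₂, hl⟩ := List.append_of_mem he
  have hp := p.isPath
  rw [hl] at hp
  exact ⟨l₁, l₂, hl, isPath_append_cons_iff.1 hp⟩

/-! ### The orders on paths induced by a framing -/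

namespace Framing

variable (𝓕 : G.Framing)

theorem outLt_irrefl (e : E) : ¬ 𝓕.outLt (G.tail e) e e :=
  (𝓕.outLt_total _ (not_isSink_tail e)).irrefl ⟨e, rfl⟩

theorem outLt_trans {v : V} {e f g : E} (he : G.tail e = v) (hf : G.tail f = v)
    (hg : G.tail g = v) (h : 𝓕.outLt v e f) (h' : 𝓕.outLt v f g) : 𝓕.outLt v e g :=
  (𝓕.outLt_total v (he ▸ not_isSink_tail e)).trans ⟨e, he⟩ ⟨f, hf⟩ ⟨g, hg⟩ h h'

theorem outLt_total' {v : V} {e f : E} (he : G.tail e = v) (hf : G.tail f = v) (hne : e ≠ f) :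
    𝓕.outLt v e f ∨ 𝓕.outLt v f e := by
  have := 𝓕.outLt_total v (he ▸ not_isSink_tail e)
  by_contra! h
  exact hne (congrArg Subtype.val (this.trichotomous ⟨e, he⟩ ⟨f, hf⟩ h.1 h.2))

theorem inLt_irrefl {v : V} (hv : G.IsInternal v) {e : E} (he : G.head e = v) :
    ¬ 𝓕.inLt v e e :=
  (𝓕.inLt_total _ hv).irrefl ⟨e, he⟩

theorem inLt_trans {v : V} (hv : G.IsInternal v) {e f g : E} (he : G.head e = v)
    (hf : G.head f = v) (hg : G.head g = v) (h : 𝓕.inLt v e f) (h' : 𝓕.inLt v f g) :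
    𝓕.inLt v e g :=
  (𝓕.inLt_total v hv).trans ⟨e, he⟩ ⟨f, hf⟩ ⟨g, hg⟩ h h'

theorem inLt_total' {v : V} (hv : G.IsInternal v) {e f : E} (he : G.head e = v)
    (hf : G.head f = v) (hne : e ≠ f) : 𝓕.inLt v e f ∨ 𝓕.inLt v f e := by
  have := 𝓕.inLt_total v hv
  by_contra! h
  exact hne (congrArg Subtype.val (this.trichotomous ⟨e, he⟩ ⟨f, hf⟩ h.1 h.2))

theorem srcLt_irrefl {v : V} (hv : G.IsSource v) : ¬ 𝓕.srcLt v v :=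
  𝓕.srcLt_total.irrefl ⟨v, hv⟩

theorem srcLt_trans {u v w : V} (hu : G.IsSource u) (hv : G.IsSource v) (hw : G.IsSource w)
    (h : 𝓕.srcLt u v) (h' : 𝓕.srcLt v w) : 𝓕.srcLt u w :=
  𝓕.srcLt_total.trans ⟨u, hu⟩ ⟨v, hv⟩ ⟨w, hw⟩ h h'

theorem srcLt_total' {u v : V} (hu : G.IsSource u) (hv : G.IsSource v) (hne : u ≠ v) :
    𝓕.srcLt u v ∨ 𝓕.srcLt v u := by
  by_contra! h
  exact hne (congrArg Subtype.val (𝓕.srcLt_total.trichotomous ⟨u, hu⟩ ⟨v, hv⟩ h.1 h.2))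

theorem not_postLt_nil_left (q : List E) : ¬ 𝓕.PostLt [] q := by
  rintro ⟨σ, p', q', f, g, h, -⟩
  simp at h

theorem not_postLt_nil_right (p : List E) : ¬ 𝓕.PostLt p [] := by
  rintro ⟨σ, p', q', f, g, -, h, -⟩
  simp at h

/-- This recursive, lexicographic form replaces the explicit common subpath and drives the order
properties by induction. -/
theorem postLt_cons_iff {e f : E} {p q : List E} :
    𝓕.PostLt (e :: p) (f :: q) ↔ 𝓕.outLt (G.tail e) e f ∨ e = f ∧ 𝓕.PostLt p q := by
  constructor
  · rintro ⟨σ, p', q', f', g', h1, h2, h3⟩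
    cases σ with
    | nil =>
      simp only [List.nil_append, List.cons.injEq] at h1 h2
      exact Or.inl (by rw [h1.1, h2.1]; exact h3)
    | cons x σ =>
      simp only [List.cons_append, List.cons.injEq] at h1 h2
      exact Or.inr ⟨h1.1.trans h2.1.symm, σ, p', q', f', g', h1.2, h2.2, h3⟩
  · rintro (h | ⟨rfl, σ, p', q', f', g', h1, h2, h3⟩)
    · exact ⟨[], p, q, e, f, rfl, rfl, h⟩
    · exact ⟨e :: σ, p', q', f', g', by simp [h1], by simp [h2], h3⟩

theorem postLt_irrefl (p : List E) : ¬ 𝓕.PostLt p p := by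
  induction p with
  | nil => exact 𝓕.not_postLt_nil_left []
  | cons e p ih =>
    rw [postLt_cons_iff]
    rintro (h | h)
    · exact 𝓕.outLt_irrefl e h
    · exact ih h.2

theorem postLt_trans {v w₁ w₂ w₃ : V} {p q r : List E} (hp : G.IsPath v p w₁)
    (hq : G.IsPath v q w₂) (hr : G.IsPath v r w₃) (h : 𝓕.PostLt p q) (h' : 𝓕.PostLt q r) :
    𝓕.PostLt p r := by
  induction p generalizing v q r with
  | nil => exact absurd h (𝓕.not_postLt_nil_left _)
  | cons e p ih =>
    cases q with
    | nil => exact absurd h (𝓕.not_postLt_nil_right _)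
    | cons f q =>
      cases r with
      | nil => exact absurd h' (𝓕.not_postLt_nil_right _)
      | cons g r =>
        obtain ⟨he, hp⟩ := isPath_cons_iff.1 hp
        obtain ⟨hf, hq⟩ := isPath_cons_iff.1 hq
        obtain ⟨hg, hr⟩ := isPath_cons_iff.1 hr
        rw [postLt_cons_iff] at h h' ⊢
        rw [he] at h ⊢
        rw [hf] at h'
        rcases h with h | ⟨rfl, h⟩ <;> rcases h' with h' | ⟨rfl, h'⟩
        · exact Or.inl (𝓕.outLt_trans he hf hg h h')
        · exact Or.inl h
        · exact Or.inl h'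
        · exact Or.inr ⟨rfl, ih hp hq hr h h'⟩

/-- Since both paths end in sinks, neither can be a proper initial part of the other, so distinct
paths do diverge. -/
theorem postLt_total {v w₁ w₂ : V} {p q : List E} (hp : G.IsPath v p w₁) (hw₁ : G.IsSink w₁)
    (hq : G.IsPath v q w₂) (hw₂ : G.IsSink w₂) (hne : p ≠ q) :
    𝓕.PostLt p q ∨ 𝓕.PostLt q p := by
  induction p generalizing v q with
  | nil =>
    cases isPath_nil_iff.1 hp
    exact absurd (hw₁.eq_nil_of_isPath hq).symm hne
  | cons e p ih =>
    cases q with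
    | nil =>
      cases isPath_nil_iff.1 hq
      exact absurd (hw₂.eq_nil_of_isPath hp) hne
    | cons f q =>
      obtain ⟨he, hp⟩ := isPath_cons_iff.1 hp
      obtain ⟨hf, hq⟩ := isPath_cons_iff.1 hq
      rw [postLt_cons_iff, postLt_cons_iff, he, hf]
      by_cases hef : e = f
      · subst hef
        rcases ih hp hq (fun h => hne (by rw [h])) with h | h
        · exact Or.inl (Or.inr ⟨rfl, h⟩)
        · exact Or.inr (Or.inr ⟨rfl, h⟩)
      · rcases 𝓕.outLt_total' he hf hef with h | h
        · exact Or.inl (Or.inl h)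
        · exact Or.inr (Or.inl h)

theorem not_preLt_nil_left (q : List E) : ¬ 𝓕.PreLt [] q := by
  rintro ⟨σ, p', q', f, g, h, -⟩
  simp at h

theorem not_preLt_nil_right (p : List E) : ¬ 𝓕.PreLt p [] := by
  rintro ⟨σ, p', q', f, g, -, h, -⟩
  simp at h

theorem preLt_snoc_iff {e f : E} {p q : List E} :
    𝓕.PreLt (p ++ [e]) (q ++ [f]) ↔ 𝓕.inLt (G.head e) e f ∨ e = f ∧ 𝓕.PreLt p q := by
  constructor
  · rintro ⟨σ, p', q', f', g', h1, h2, h3⟩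
    rcases List.eq_nil_or_concat σ with rfl | ⟨σ, x, rfl⟩
    · obtain ⟨-, h1⟩ := List.append_inj' h1 rfl
      obtain ⟨-, h2⟩ := List.append_inj' h2 rfl
      simp only [List.cons.injEq, and_true] at h1 h2
      exact Or.inl (by rw [h1, h2]; exact h3)
    · rw [List.concat_eq_append, ← List.cons_append, ← List.append_assoc] at h1 h2
      obtain ⟨h1, h1'⟩ := List.append_inj' h1 rfl
      obtain ⟨h2, h2'⟩ := List.append_inj' h2 rfl
      simp only [List.cons.injEq, and_true] at h1' h2'
      exact Or.inr ⟨h1'.trans h2'.symm, σ, p', q', f', g', h1, h2, h3⟩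
  · rintro (h | ⟨rfl, σ, p', q', f', g', h1, h2, h3⟩)
    · exact ⟨[], p, q, e, f, rfl, rfl, h⟩
    · exact ⟨σ ++ [e], p', q', f', g', by simp [h1], by simp [h2], h3⟩

/-- The end of a nonempty path is never a source; as it is not a sink it is internal, the only kind
of vertex at which `inLt` is known to be an order. -/
theorem preLt_irrefl {u v : V} {p : List E} (hp : G.IsPath u p v) (hv : ¬ G.IsSink v) :
    ¬ 𝓕.PreLt p p := by
  induction p using List.reverseRecOn generalizing v with
  | nil => exact 𝓕.not_preLt_nil_left []
  | append_singleton p e ih =>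
    obtain ⟨hp', rfl⟩ := isPath_snoc_iff.1 hp
    rw [preLt_snoc_iff]
    rintro (h | h)
    · exact 𝓕.inLt_irrefl ⟨not_isSource_head e, hv⟩ rfl h
    · exact ih hp' (not_isSink_tail e) h.2

theorem preLt_trans {v u₁ u₂ u₃ : V} (hv : ¬ G.IsSink v) {p q r : List E} (hp : G.IsPath u₁ p v)
    (hq : G.IsPath u₂ q v) (hr : G.IsPath u₃ r v) (h : 𝓕.PreLt p q) (h' : 𝓕.PreLt q r) :
    𝓕.PreLt p r := by
  induction p using List.reverseRecOn generalizing v q r with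
  | nil => exact absurd h (𝓕.not_preLt_nil_left _)
  | append_singleton p e ih =>
    rcases List.eq_nil_or_concat q with rfl | ⟨q, f, rfl⟩
    · exact absurd h (𝓕.not_preLt_nil_right _)
    rcases List.eq_nil_or_concat r with rfl | ⟨r, g, rfl⟩
    · exact absurd h' (𝓕.not_preLt_nil_right _)
    simp only [List.concat_eq_append] at *
    obtain ⟨hp, he⟩ := isPath_snoc_iff.1 hp
    obtain ⟨hq, hf⟩ := isPath_snoc_iff.1 hq
    obtain ⟨hr, hg⟩ := isPath_snoc_iff.1 hr
    have hv' : G.IsInternal v := ⟨he ▸ not_isSource_head e, hv⟩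
    rw [preLt_snoc_iff] at h h' ⊢
    rw [he] at h ⊢
    rw [hf] at h'
    rcases h with h | ⟨rfl, h⟩ <;> rcases h' with h' | ⟨rfl, h'⟩
    · exact Or.inl (𝓕.inLt_trans hv' he hf hg h h')
    · exact Or.inl h
    · exact Or.inl h'
    · exact Or.inr ⟨rfl, ih (not_isSink_tail e) hp hq hr h h'⟩

theorem preLt_total {v u₁ u₂ : V} (hv : ¬ G.IsSink v) {p q : List E} (hp : G.IsPath u₁ p v)
    (hu₁ : G.IsSource u₁) (hq : G.IsPath u₂ q v) (hu₂ : G.IsSource u₂) (hne : p ≠ q) :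
    𝓕.PreLt p q ∨ 𝓕.PreLt q p := by
  induction p using List.reverseRecOn generalizing v q with
  | nil =>
    cases isPath_nil_iff.1 hp
    exact absurd (hu₁.eq_nil_of_isPath hq).symm hne
  | append_singleton p e ih =>
    rcases List.eq_nil_or_concat q with rfl | ⟨q, f, rfl⟩
    · cases isPath_nil_iff.1 hq
      exact absurd (hu₂.eq_nil_of_isPath hp) hne
    simp only [List.concat_eq_append] at *
    obtain ⟨hp, he⟩ := isPath_snoc_iff.1 hp
    obtain ⟨hq, hf⟩ := isPath_snoc_iff.1 hq
    have hv' : G.IsInternal v := ⟨he ▸ not_isSource_head e, hv⟩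
    rw [preLt_snoc_iff, preLt_snoc_iff, he, hf]
    by_cases hef : e = f
    · subst hef
      rcases ih (not_isSink_tail e) hp hq (fun h => hne (by rw [h])) with h | h
      · exact Or.inl (Or.inr ⟨rfl, h⟩)
      · exact Or.inr (Or.inr ⟨rfl, h⟩)
    · rcases 𝓕.inLt_total' hv' he hf hef with h | h
      · exact Or.inl (Or.inl h)
      · exact Or.inr (Or.inl h)

end Framing

end DiMultigraph

/-! ### Sums over paths, and induction along the graph -/

namespace DiMultigraph

variable {V E : Type*} {G : DiMultigraph V E}

theorem IsPath.start_unique {u u' w : V} {l : List E} (h : G.IsPath u l w)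
    (h' : G.IsPath u' l w) : u = u' := by
  cases l with
  | nil => rw [isPath_nil_iff.1 h, isPath_nil_iff.1 h']
  | cons e l => rw [← (isPath_cons_iff.1 h).1, (isPath_cons_iff.1 h').1]

theorem IsPath.finish_unique {u w w' : V} {l : List E} (h : G.IsPath u l w)
    (h' : G.IsPath u l w') : w = w' := by
  rcases List.eq_nil_or_concat l with rfl | ⟨l, e, rfl⟩
  · rw [← isPath_nil_iff.1 h, isPath_nil_iff.1 h']
  · rw [List.concat_eq_append] at h h'
    rw [← (isPath_snoc_iff.1 h).2, (isPath_snoc_iff.1 h').2]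

section PathSets

variable [Finite E]

/-- The paths from sources to `v`. -/
noncomputable def sourcePaths (hG : G.IsAcyclic) (v : V) : Finset (List E) :=
  ((finite_setOf_isPath hG).subset
    (show {l | ∃ u, G.IsSource u ∧ G.IsPath u l v} ⊆ _ from
      fun _ ⟨u, _, h⟩ => ⟨u, v, h⟩)).toFinset

/-- The paths from `v` to sinks. -/
noncomputable def sinkPaths (hG : G.IsAcyclic) (v : V) : Finset (List E) :=
  ((finite_setOf_isPath hG).subset
    (show {l | ∃ w, G.IsSink w ∧ G.IsPath v l w} ⊆ _ from
      fun _ ⟨w, _, h⟩ => ⟨v, w, h⟩)).toFinset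

theorem mem_sourcePaths {hG : G.IsAcyclic} {v : V} {l : List E} :
    l ∈ sourcePaths hG v ↔ ∃ u, G.IsSource u ∧ G.IsPath u l v := by
  simp [sourcePaths]

theorem mem_sinkPaths {hG : G.IsAcyclic} {v : V} {l : List E} :
    l ∈ sinkPaths hG v ↔ ∃ w, G.IsSink w ∧ G.IsPath v l w := by
  simp [sinkPaths]

theorem sourcePaths_of_isSource {hG : G.IsAcyclic} {v : V} (hv : G.IsSource v) :
    sourcePaths hG v = {[]} := by
  ext l
  rw [mem_sourcePaths, Finset.mem_singleton]
  exact ⟨fun ⟨_, _, h⟩ => hv.eq_nil_of_isPath h, fun h => ⟨v, hv, h ▸ .nil v⟩⟩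

theorem sinkPaths_of_isSink {hG : G.IsAcyclic} {v : V} (hv : G.IsSink v) :
    sinkPaths hG v = {[]} := by
  ext l
  rw [mem_sinkPaths, Finset.mem_singleton]
  exact ⟨fun ⟨_, _, h⟩ => hv.eq_nil_of_isPath h, fun h => ⟨v, hv, h ▸ .nil v⟩⟩

end PathSets

section PathSums

variable [Fintype E]

open Classical in
theorem sum_sourcePaths {hG : G.IsAcyclic} {v : V} (hv : ¬ G.IsSource v) (g : List E → ℝ) :
    ∑ l ∈ sourcePaths hG v, g l =
      ∑ f with G.head f = v, ∑ l ∈ sourcePaths hG (G.tail f), g (l ++ [f]) := by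
  have h : sourcePaths hG v = (Finset.univ.filter fun f => G.head f = v).biUnion
      fun f => (sourcePaths hG (G.tail f)).image (· ++ [f]) := by
    ext l
    simp only [mem_sourcePaths, Finset.mem_biUnion, Finset.mem_filter, Finset.mem_univ, true_and,
      Finset.mem_image]
    constructor
    · rintro ⟨u, hu, h⟩
      rcases List.eq_nil_or_concat l with rfl | ⟨l, e, rfl⟩
      · exact absurd (isPath_nil_iff.1 h ▸ hu) hv
      · rw [List.concat_eq_append, isPath_snoc_iff] at h
        exact ⟨e, h.2, l, ⟨u, hu, h.1⟩, by simp⟩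
    · rintro ⟨f, hf, l, ⟨u, hu, h⟩, rfl⟩
      exact ⟨u, hu, isPath_snoc_iff.2 ⟨h, hf⟩⟩
  rw [h, Finset.sum_biUnion]
  · refine Finset.sum_congr rfl fun f _ => Finset.sum_image fun l _ l' _ h => ?_
    simpa using h
  · intro f _ f' _ hne
    refine Finset.disjoint_left.2 fun l hl hl' => hne ?_
    obtain ⟨m, -, rfl⟩ := Finset.mem_image.1 hl
    obtain ⟨m', -, h⟩ := Finset.mem_image.1 hl'
    have := (List.append_inj' h rfl).2
    simp only [List.cons.injEq, and_true] at this
    exact this.symm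

open Classical in
theorem sum_sinkPaths {hG : G.IsAcyclic} {v : V} (hv : ¬ G.IsSink v) (g : List E → ℝ) :
    ∑ l ∈ sinkPaths hG v, g l =
      ∑ f with G.tail f = v, ∑ l ∈ sinkPaths hG (G.head f), g (f :: l) := by
  have h : sinkPaths hG v = (Finset.univ.filter fun f => G.tail f = v).biUnion
      fun f => (sinkPaths hG (G.head f)).image (f :: ·) := by
    ext l
    simp only [mem_sinkPaths, Finset.mem_biUnion, Finset.mem_filter, Finset.mem_univ, true_and,
      Finset.mem_image]
    constructor
    · rintro ⟨u, hu, h⟩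
      cases l with
      | nil => exact absurd (isPath_nil_iff.1 h ▸ hu) hv
      | cons e l =>
        rw [isPath_cons_iff] at h
        exact ⟨e, h.1, l, ⟨u, hu, h.2⟩, rfl⟩
    · rintro ⟨f, hf, l, ⟨u, hu, h⟩, rfl⟩
      exact ⟨u, hu, isPath_cons_iff.2 ⟨hf, h⟩⟩
  rw [h, Finset.sum_biUnion]
  · refine Finset.sum_congr rfl fun f _ => Finset.sum_image fun l _ l' _ h => ?_
    simpa using h
  · intro f _ f' _ hne
    refine Finset.disjoint_left.2 fun l hl hl' => hne ?_
    obtain ⟨m, -, rfl⟩ := Finset.mem_image.1 hl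
    obtain ⟨m', -, h⟩ := Finset.mem_image.1 hl'
    simp only [List.cons.injEq] at h
    exact h.1.symm

end PathSums

/-- Reachability in an acyclic graph is a strict order, hence well-founded on finitely many
vertices. -/
theorem IsAcyclic.induction_forward [Finite V] (hG : G.IsAcyclic) {P : V → Prop}
    (h : ∀ v, (∀ f, G.head f = v → P (G.tail f)) → P v) (v : V) : P v := by
  have : IsTrans V (Relation.TransGen fun u w => ∃ e, G.tail e = u ∧ G.head e = w) :=
    ⟨fun _ _ _ => Relation.TransGen.trans⟩
  have : Std.Irrefl (Relation.TransGen fun u w => ∃ e, G.tail e = u ∧ G.head e = w) := ⟨hG⟩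
  exact (Finite.wellFounded_of_trans_of_irrefl
    (Relation.TransGen fun u w => ∃ e, G.tail e = u ∧ G.head e = w)).induction v
    fun v ih => h v fun f hf => ih _ (Relation.TransGen.single ⟨f, rfl, hf⟩)

theorem IsAcyclic.induction_backward [Finite V] (hG : G.IsAcyclic) {P : V → Prop}
    (h : ∀ v, (∀ f, G.tail f = v → P (G.head f)) → P v) (v : V) : P v := by
  have : IsTrans V (Function.swap
      (Relation.TransGen fun u w => ∃ e, G.tail e = u ∧ G.head e = w)) :=
    ⟨fun _ _ _ h h' => Relation.TransGen.trans h' h⟩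
  have : Std.Irrefl (Function.swap
      (Relation.TransGen fun u w => ∃ e, G.tail e = u ∧ G.head e = w)) := ⟨hG⟩
  exact (Finite.wellFounded_of_trans_of_irrefl (Function.swap
    (Relation.TransGen fun u w => ∃ e, G.tail e = u ∧ G.head e = w))).induction v
    fun v ih => h v fun f hf => ih _ (Relation.TransGen.single ⟨f, hf, rfl⟩)

/-! ### The stacked decomposition of a flow and its order properties -/

namespace Framing

variable [Fintype E] (𝓕 : G.Framing) (F : E → ℝ)

open Classical in
/-- The total flow on the edges with the head of `e` that precede `e`. -/
noncomputable def inBase (e : E) : ℝ :=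
  ∑ f with G.head f = G.head e ∧ 𝓕.inLt (G.head e) f e, F f

open Classical in
/-- The total flow on the edges with the tail of `e` that precede `e`. -/
noncomputable def outBase (e : E) : ℝ :=
  ∑ f with G.tail f = G.tail e ∧ 𝓕.outLt (G.tail e) f e, F f

/-- The flow through the vertex between `e` and `e'` is stacked by the order of incoming edges and
by the order of outgoing edges; of the part of the stack that lies below height `t` of `e`, this is
the amount that continues by `e'`. -/
noncomputable def step (e e' : E) (t : ℝ) : ℝ :=
  min (𝓕.inBase F e + t) (𝓕.outBase F e' + F e') - min (𝓕.inBase F e + t) (𝓕.outBase F e')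

/-- Follow a height in `e` along the path `e :: l`. -/
noncomputable def push : E → List E → ℝ → ℝ
  | _, [], t => t
  | e, e' :: l, t => push e' l (𝓕.step F e e' t)

/-- Follow the height `s` along the path `l ++ [e]`, starting from its first edge. -/
noncomputable def height (s : E → ℝ) : List E → E → ℝ
  | [], e => s e
  | e₁ :: l, e => 𝓕.push F e₁ (l ++ [e]) (s e₁)

/-- The weight of a path in the stacked decomposition of `F`. -/
noncomputable def pathWeight : List E → ℝ
  | [] => 0
  | e :: l => 𝓕.push F e l (F e) - 𝓕.push F e l 0

variable {𝓕 F}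

theorem push_append_cons (e e' : E) (l l' : List E) (t : ℝ) :
    𝓕.push F e (l ++ e' :: l') t = 𝓕.push F e' l' (𝓕.push F e (l ++ [e']) t) := by
  induction l generalizing e t with
  | nil => rfl
  | cons f l ih => exact ih f _

theorem height_append_cons (s : E → ℝ) (l l' : List E) (e e' : E) :
    𝓕.height F s (l ++ e :: l') e' = 𝓕.push F e (l' ++ [e']) (𝓕.height F s l e) := by
  cases l with
  | nil => rfl
  | cons e₁ l => simp [height, push_append_cons (e' := e) (l' := l' ++ [e'])]

theorem height_snoc (s : E → ℝ) (l : List E) (e e' : E) :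
    𝓕.height F s (l ++ [e]) e' = 𝓕.step F e e' (𝓕.height F s l e) :=
  height_append_cons s l [] e e'

/-- The path `l` occupies the interval from `height F 0 l e` to `height F F l e` inside `e`; the
weight is the width of what remains of it after following `l'`. -/
theorem pathWeight_append_cons (l l' : List E) (e : E) :
    𝓕.pathWeight F (l ++ e :: l') =
      𝓕.push F e l' (𝓕.height F F l e) - 𝓕.push F e l' (𝓕.height F 0 l e) := by
  cases l with
  | nil => rfl
  | cons e₁ l => simp [height, pathWeight, push_append_cons (e' := e) (l' := l')]

theorem outBase_nonneg (h0 : ∀ e, 0 ≤ F e)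
    (e : E) : 0 ≤ 𝓕.outBase F e := Finset.sum_nonneg fun _ _ => h0 _

theorem inBase_nonneg (h0 : ∀ e, 0 ≤ F e)
    (e : E) : 0 ≤ 𝓕.inBase F e := Finset.sum_nonneg fun _ _ => h0 _

open Classical in
theorem outBase_add_le (h0 : ∀ e, 0 ≤ F e) (e : E) :
    𝓕.outBase F e + F e ≤ ∑ f with G.tail f = G.tail e, F f := by
  rw [outBase, add_comm, ← Finset.sum_insert (s := Finset.univ.filter _)]
  · refine Finset.sum_le_sum_of_subset_of_nonneg (fun f hf => ?_) fun _ _ _ => h0 _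
    simp only [Finset.mem_insert, Finset.mem_filter, Finset.mem_univ, true_and] at hf ⊢
    rcases hf with rfl | hf
    · rfl
    · exact hf.1
  · simp [𝓕.outLt_irrefl e]

open Classical in
theorem inBase_add_le (h0 : ∀ e, 0 ≤ F e) {e : E} (he : G.IsInternal (G.head e)) :
    𝓕.inBase F e + F e ≤ ∑ f with G.head f = G.head e, F f := by
  rw [inBase, add_comm, ← Finset.sum_insert (s := Finset.univ.filter _)]
  · refine Finset.sum_le_sum_of_subset_of_nonneg (fun f hf => ?_) fun _ _ _ => h0 _
    simp only [Finset.mem_insert, Finset.mem_filter, Finset.mem_univ, true_and] at hf ⊢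
    rcases hf with rfl | hf
    · rfl
    · exact hf.1
  · simp [𝓕.inLt_irrefl he rfl]

/-- Stacked intervals do not overlap: the top of `e` lies below the base of any later edge. -/
theorem outBase_add_le_outBase (h0 : ∀ e, 0 ≤ F e) {e f : E} (hef : G.tail e = G.tail f)
    (h : 𝓕.outLt (G.tail e) e f) : 𝓕.outBase F e + F e ≤ 𝓕.outBase F f := by
  classical
  rw [outBase, add_comm, ← Finset.sum_insert (s := Finset.univ.filter _)]
  · refine Finset.sum_le_sum_of_subset_of_nonneg (fun g hg => ?_) fun _ _ _ => h0 _
    simp only [Finset.mem_insert, Finset.mem_filter, Finset.mem_univ, true_and] at hg ⊢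
    rw [← hef]
    rcases hg with rfl | ⟨hg, hlt⟩
    · exact ⟨rfl, h⟩
    · exact ⟨hg, 𝓕.outLt_trans hg rfl hef.symm hlt h⟩
  · simp [𝓕.outLt_irrefl e]

theorem inBase_add_le_inBase (h0 : ∀ e, 0 ≤ F e)
    {e f : E} (he : G.IsInternal (G.head e)) (hef : G.head e = G.head f)
    (h : 𝓕.inLt (G.head e) e f) : 𝓕.inBase F e + F e ≤ 𝓕.inBase F f := by
  classical
  rw [inBase, add_comm, ← Finset.sum_insert (s := Finset.univ.filter _)]
  · refine Finset.sum_le_sum_of_subset_of_nonneg (fun g hg => ?_) fun _ _ _ => h0 _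
    simp only [Finset.mem_insert, Finset.mem_filter, Finset.mem_univ, true_and] at hg ⊢
    rw [← hef]
    rcases hg with rfl | ⟨hg, hlt⟩
    · exact ⟨rfl, h⟩
    · exact ⟨hg, 𝓕.inLt_trans he hg rfl hef.symm hlt h⟩
  · simp [𝓕.inLt_irrefl he rfl]

/-- `step` truncates the absolute height `inBase + t` to the interval of `c` in the outgoing stack.
It is therefore monotone in that height even when the two incoming edges differ, which is what keeps
merged paths in order. -/
theorem step_le_step (h0 : ∀ e, 0 ≤ F e)
    {e f c : E} {t u : ℝ} (h : 𝓕.inBase F e + t ≤ 𝓕.inBase F f + u) :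
    𝓕.step F e c t ≤ 𝓕.step F f c u := by
  have := h0 c
  unfold step
  rcases min_cases (𝓕.inBase F e + t) (𝓕.outBase F c + F c) with h1 | h1 <;>
  rcases min_cases (𝓕.inBase F e + t) (𝓕.outBase F c) with h2 | h2 <;>
  rcases min_cases (𝓕.inBase F f + u) (𝓕.outBase F c + F c) with h3 | h3 <;>
  rcases min_cases (𝓕.inBase F f + u) (𝓕.outBase F c) with h4 | h4 <;>
  linarith [h1.1, h2.1, h3.1, h4.1, h1.2, h2.2, h3.2, h4.2]

theorem step_nonneg (h0 : ∀ e, 0 ≤ F e) (e c : E) (t : ℝ) : 0 ≤ 𝓕.step F e c t :=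
  sub_nonneg.2 (min_le_min_left _ (by linarith [h0 c]))

theorem step_le (h0 : ∀ e, 0 ≤ F e) (e c : E) (t : ℝ) : 𝓕.step F e c t ≤ F c := by
  have := h0 c
  unfold step
  rcases min_cases (𝓕.inBase F e + t) (𝓕.outBase F c + F c) with h1 | h1 <;>
  rcases min_cases (𝓕.inBase F e + t) (𝓕.outBase F c) with h2 | h2 <;>
  linarith [h1.1, h2.1, h1.2, h2.2]

theorem push_mono (h0 : ∀ e, 0 ≤ F e) (e : E) (l : List E) : Monotone (𝓕.push F e l) := by
  induction l generalizing e with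
  | nil => exact monotone_id
  | cons f l ih => exact fun t u h => ih f (step_le_step h0 (by linarith))

theorem height_mono (h0 : ∀ e, 0 ≤ F e) {s s' : E → ℝ} (hs : s ≤ s') (l : List E) (e : E) :
    𝓕.height F s l e ≤ 𝓕.height F s' l e := by
  cases l with
  | nil => exact hs e
  | cons f l => exact push_mono h0 _ _ (hs f)

theorem height_zero_le (h0 : ∀ e, 0 ≤ F e)
    (l : List E) (e : E) : 𝓕.height F 0 l e ≤ 𝓕.height F F l e :=
  height_mono h0 (fun e => h0 e) l e

theorem height_zero_nonneg (h0 : ∀ e, 0 ≤ F e) (l : List E) (e : E) : 0 ≤ 𝓕.height F 0 l e := by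
  rcases List.eq_nil_or_concat l with rfl | ⟨l, f, rfl⟩
  · exact le_rfl
  · rw [List.concat_eq_append, height_snoc]
    exact step_nonneg h0 _ _ _

theorem height_self_le (h0 : ∀ e, 0 ≤ F e) (l : List E) (e : E) : 𝓕.height F F l e ≤ F e := by
  rcases List.eq_nil_or_concat l with rfl | ⟨l, f, rfl⟩
  · exact le_rfl
  · rw [List.concat_eq_append, height_snoc]
    exact step_le h0 _ _ _

theorem pathWeight_nonneg (h0 : ∀ e, 0 ≤ F e) (l : List E) : 0 ≤ 𝓕.pathWeight F l := by
  cases l with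
  | nil => exact le_rfl
  | cons e l => exact sub_nonneg.2 (push_mono h0 _ _ (h0 e))

/-- Two paths that are separated when they merge stay separated until they diverge. -/
theorem push_eq_of_separated (h0 : ∀ e, 0 ≤ F e) {f g f' g' : E} (s : List E) {t u : ℝ}
    (h : 𝓕.inBase F f + t ≤ 𝓕.inBase F g + u) (hfg : 𝓕.outBase F g' + F g' ≤ 𝓕.outBase F f') :
    𝓕.push F f (s ++ [f']) t ≤ 0 ∨ F g' ≤ 𝓕.push F g (s ++ [g']) u := by
  induction s generalizing f g t u with
  | nil =>
    have h1 := h0 f'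
    have h2 := h0 g'
    -- If the lower height does not exceed the base of `f'`, nothing of it enters `f'`; otherwise
    -- the upper height already exceeds the top of `g'` and fills it.
    rcases le_total (𝓕.inBase F f + t) (𝓕.outBase F f') with h3 | h3
    · left
      simp only [List.nil_append, push, step]
      rw [min_eq_left h3, min_eq_left (by linarith)]
      linarith
    · right
      simp only [List.nil_append, push, step]
      rw [min_eq_right (by linarith), min_eq_right (by linarith)]
      linarith
  | cons c s ih =>
    exact ih (add_le_add le_rfl (step_le_step h0 h))

/-- Where the routes merge, the interval of `p` lies below that of `q`, and this persists along
their common part. But `p` leaves by the later edge, so either the top of `p` falls to `0` in `f'`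
or the bottom of `q` rises to the full width of `g'`. In either case an interval degenerates. -/
theorem pathWeight_eq_zero_of_crossAt (h0 : ∀ e, 0 ≤ F e)
    {i : V} {p q : G.Route} (h : 𝓕.CrossAt i p q) :
    𝓕.pathWeight F p.edges = 0 ∨ 𝓕.pathWeight F q.edges = 0 := by
  obtain ⟨p₁, p₂, q₁, q₂, hp, hp₁, hp₂, hq, hq₁, hq₂, ⟨σ, p₁', q₁', f, g, rfl, rfl, hin⟩,
    ⟨ρ, q₂', p₂', g', f', rfl, rfl, hout⟩⟩ := h
  have hfσ := (isPath_append_cons_iff.1 hp₁).2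
  have hgσ := (isPath_append_cons_iff.1 hq₁).2
  have hfρ := (isPath_append_cons_iff.1 hp₂).1
  have hgρ := (isPath_append_cons_iff.1 hq₂).1
  have hhead : G.head f = G.head g := hfσ.start_unique hgσ
  have htail : G.tail g' = G.tail f' := hgρ.finish_unique hfρ
  have hpath : G.IsPath (G.head f) (σ ++ ρ ++ [f']) (G.head f') := by
    rw [isPath_snoc_iff, isPath_append_iff]
    exact ⟨⟨i, hfσ, hfρ⟩, rfl⟩
  have hinn : G.IsInternal (G.head f) :=
    ⟨not_isSource_head f, fun hs => by simpa using hs.eq_nil_of_isPath hpath⟩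
  have hp' : p.edges = (p₁' ++ f :: (σ ++ ρ)) ++ f' :: p₂' := by simp [hp]
  have hq' : q.edges = (q₁' ++ g :: (σ ++ ρ)) ++ g' :: q₂' := by simp [hq]
  have hsep : 𝓕.inBase F f + 𝓕.height F F p₁' f ≤ 𝓕.inBase F g + 𝓕.height F 0 q₁' g := by
    have h1 := inBase_add_le_inBase h0 hinn hhead hin
    have h2 := height_self_le (𝓕 := 𝓕) h0 p₁' f
    have h3 := height_zero_nonneg (𝓕 := 𝓕) h0 q₁' g
    linarith
  rw [hp', hq', pathWeight_append_cons, pathWeight_append_cons]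
  rcases push_eq_of_separated h0 (σ ++ ρ) hsep (outBase_add_le_outBase h0 htail hout) with h | h
  · left
    rw [← height_append_cons] at h
    have h1 := height_zero_nonneg (𝓕 := 𝓕) h0 (p₁' ++ f :: (σ ++ ρ)) f'
    have h2 := height_zero_le (𝓕 := 𝓕) h0 (p₁' ++ f :: (σ ++ ρ)) f'
    rw [show 𝓕.height F F (p₁' ++ f :: (σ ++ ρ)) f' = 𝓕.height F 0 (p₁' ++ f :: (σ ++ ρ)) f' by
      linarith, sub_self]
  · right
    rw [← height_append_cons] at h
    have h1 := height_self_le (𝓕 := 𝓕) h0 (q₁' ++ g :: (σ ++ ρ)) g'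
    have h2 := height_zero_le (𝓕 := 𝓕) h0 (q₁' ++ g :: (σ ++ ρ)) g'
    rw [show 𝓕.height F F (q₁' ++ g :: (σ ++ ρ)) g' = 𝓕.height F 0 (q₁' ++ g :: (σ ++ ρ)) g' by
      linarith, sub_self]

theorem isRouteClique_support_pathWeight (h0 : ∀ e, 0 ≤ F e) :
    𝓕.IsRouteClique {p : G.Route | 𝓕.pathWeight F p.edges ≠ 0} := by
  intro p hp q hq _ i
  constructor
  · intro h
    rcases pathWeight_eq_zero_of_crossAt h0 h with h | h
    exacts [hp h, hq h]
  · intro h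
    rcases pathWeight_eq_zero_of_crossAt h0 h with h | h
    exacts [hq h, hp h]

/-! ### The stacked weights sum to the flow -/

open Classical in
theorem sum_out_telescope (χ : ℝ → ℝ) (v : V) :
    ∑ e with G.tail e = v, (χ (𝓕.outBase F e + F e) - χ (𝓕.outBase F e)) =
      χ (∑ e with G.tail e = v, F e) - χ 0 := by
  rw [← Finset.sum_stack_telescope (S := Finset.univ.filter fun e => G.tail e = v)
    (r := 𝓕.outLt v) F χ]
  · refine Finset.sum_congr rfl fun e he => ?_
    have he : G.tail e = v := by simpa using he
    simp only [outBase, Finset.filter_filter, he]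
  · intro e he
    obtain rfl : G.tail e = v := by simpa using he
    exact 𝓕.outLt_irrefl e
  · intro e he f hf g hg
    simp only [Finset.mem_filter, Finset.mem_univ, true_and] at he hf hg
    exact 𝓕.outLt_trans he hf hg
  · intro e he f hf
    simp only [Finset.mem_filter, Finset.mem_univ, true_and] at he hf
    exact 𝓕.outLt_total' he hf

open Classical in
theorem sum_in_telescope (χ : ℝ → ℝ) {v : V} (hv : G.IsInternal v) :
    ∑ e with G.head e = v, (χ (𝓕.inBase F e + F e) - χ (𝓕.inBase F e)) =
      χ (∑ e with G.head e = v, F e) - χ 0 := by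
  rw [← Finset.sum_stack_telescope (S := Finset.univ.filter fun e => G.head e = v)
    (r := 𝓕.inLt v) F χ]
  · refine Finset.sum_congr rfl fun e he => ?_
    have he : G.head e = v := by simpa using he
    simp only [inBase, Finset.filter_filter, he]
  · intro e he
    simp only [Finset.mem_filter, Finset.mem_univ, true_and] at he
    exact 𝓕.inLt_irrefl hv he
  · intro e he f hf g hg
    simp only [Finset.mem_filter, Finset.mem_univ, true_and] at he hf hg
    exact 𝓕.inLt_trans hv he hf hg
  · intro e he f hf
    simp only [Finset.mem_filter, Finset.mem_univ, true_and] at he hf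
    exact 𝓕.inLt_total' hv he hf

open Classical in
/-- The paths from sources to `e` tile the interval `[0, F e]`. -/
theorem sum_height_telescope (h0 : ∀ e, 0 ≤ F e)
    (hcons : ∀ v, G.IsInternal v → ∑ e with G.tail e = v, F e = ∑ e with G.head e = v, F e)
    [Finite V] (hG : G.IsAcyclic) (e : E) (ψ : ℝ → ℝ) :
    ∑ l ∈ sourcePaths hG (G.tail e), (ψ (𝓕.height F F l e) - ψ (𝓕.height F 0 l e)) =
      ψ (F e) - ψ 0 := by
  obtain ⟨v, hv⟩ : ∃ v, G.tail e = v := ⟨_, rfl⟩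
  rw [hv]
  induction v using hG.induction_forward generalizing e ψ with
  | h v ih =>
    by_cases hs : G.IsSource v
    · simp [sourcePaths_of_isSource hs, height]
    · have hinn : G.IsInternal v := ⟨hs, hv ▸ not_isSink_tail e⟩
      rw [sum_sourcePaths hs]
      -- `χ` is `ψ` after the step into `e`, read as a function of absolute height at `v`. The
      -- induction hypothesis is used for each incoming `f` with the test function `χ (inBase f +
      -- ·)`, which is why `ψ` is arbitrary.
      set χ : ℝ → ℝ := fun s => ψ (min s (𝓕.outBase F e + F e) - min s (𝓕.outBase F e)) with hχ
      have key : ∀ f ∈ Finset.univ.filter (fun f => G.head f = v),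
          ∑ l ∈ sourcePaths hG (G.tail f),
            (ψ (𝓕.height F F (l ++ [f]) e) - ψ (𝓕.height F 0 (l ++ [f]) e)) =
          χ (𝓕.inBase F f + F f) - χ (𝓕.inBase F f) := by
        intro f hf
        have := ih f (by simpa using hf) f (fun t => χ (𝓕.inBase F f + t)) rfl
        simp only [add_zero] at this
        rw [← this]
        refine Finset.sum_congr rfl fun l _ => ?_
        rw [height_snoc, height_snoc]
        rfl
      -- The incoming stack telescopes to its full height. By conservation this is the height of the
      -- outgoing stack, which contains the whole interval of `e`, so `χ` takes the values `ψ (F e)`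
      -- and `ψ 0` at the ends.
      rw [Finset.sum_congr rfl key, sum_in_telescope χ hinn, ← hcons v hinn]
      have h1 := outBase_add_le (𝓕 := 𝓕) h0 e
      have h2 := outBase_nonneg (𝓕 := 𝓕) h0 e
      have h3 := h0 e
      rw [hv] at h1
      simp only [hχ]
      rw [min_eq_right h1, min_eq_right (by linarith), min_eq_left h2, min_eq_left (by linarith)]
      simp

open Classical in
/-- The continuations of a piece of `e` to the sinks have the total width of that piece. -/
theorem sum_push_sub (h0 : ∀ e, 0 ≤ F e)
    (hcons : ∀ v, G.IsInternal v → ∑ e with G.tail e = v, F e = ∑ e with G.head e = v, F e)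
    [Finite V] (hG : G.IsAcyclic) (e : E) {t u : ℝ} (ht0 : 0 ≤ t)
    (ht : t ≤ F e) (hu0 : 0 ≤ u) (hu : u ≤ F e) :
    ∑ l ∈ sinkPaths hG (G.head e), (𝓕.push F e l t - 𝓕.push F e l u) = t - u := by
  obtain ⟨v, hv⟩ : ∃ v, G.head e = v := ⟨_, rfl⟩
  rw [hv]
  induction v using hG.induction_backward generalizing e t u with
  | h v ih =>
    by_cases hs : G.IsSink v
    · simp [sinkPaths_of_isSink hs, push]
    · have hinn : G.IsInternal v := ⟨hv ▸ not_isSource_head e, hs⟩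
      rw [sum_sinkPaths hs]
      have key : ∀ f ∈ Finset.univ.filter (fun f => G.tail f = v),
          ∑ l ∈ sinkPaths hG (G.head f), (𝓕.push F e (f :: l) t - 𝓕.push F e (f :: l) u) =
          𝓕.step F e f t - 𝓕.step F e f u := by
        intro f hf
        exact ih f (by simpa using hf) f (step_nonneg h0 _ _ _) (step_le h0 _ _ _)
          (step_nonneg h0 _ _ _) (step_le h0 _ _ _) rfl
      rw [Finset.sum_congr rfl key, Finset.sum_sub_distrib]
      -- The outgoing intervals cover everything below absolute height `inBase + s`, since by
      -- conservation the outgoing stack is at least that high. The term `inBase` cancels in the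
      -- difference.
      have tele : ∀ s, 0 ≤ s → s ≤ F e →
          ∑ f with G.tail f = v, 𝓕.step F e f s = 𝓕.inBase F e + s := by
        intro s hs0 hsF
        have h1 := inBase_add_le (𝓕 := 𝓕) h0 (hv.symm ▸ hinn : G.IsInternal (G.head e))
        have h2 := inBase_nonneg (𝓕 := 𝓕) h0 e
        rw [hv, ← hcons v hinn] at h1
        have := sum_out_telescope (𝓕 := 𝓕) (F := F) (fun u => min (𝓕.inBase F e + s) u) v
        simp only [step]
        rw [this, min_eq_left (by linarith), min_eq_right (by linarith)]
        ring
      rw [tele t ht0 ht, tele u hu0 hu]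
      ring

-- A route through `e` is a source path to `e` together with a sink path from `e`. Summing over the
-- latter recovers the width that the former occupies in `e`, and these widths tile `[0, F e]`.
open Classical in
theorem sum_pathWeight_mul_indicator (h0 : ∀ e, 0 ≤ F e)
    (hcons : ∀ v, G.IsInternal v → ∑ e with G.tail e = v, F e = ∑ e with G.head e = v, F e)
    [Finite V] [Fintype G.Route] (hG : G.IsAcyclic) :
    ∑ p : G.Route, 𝓕.pathWeight F p.edges • p.indicator = F := by
  funext e
  have h1 : (∑ p : G.Route, 𝓕.pathWeight F p.edges • p.indicator) e =
      ∑ p : G.Route with e ∈ p.edges, 𝓕.pathWeight F p.edges := by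
    simp [Finset.sum_apply, Route.indicator, Finset.sum_filter]
  have h2 : (Finset.univ.filter fun p : G.Route => e ∈ p.edges).image Route.edges =
      (sourcePaths hG (G.tail e) ×ˢ sinkPaths hG (G.head e)).image
        fun x => x.1 ++ e :: x.2 := by
    ext l
    simp only [Finset.mem_image, Finset.mem_filter, Finset.mem_univ, true_and,
      Finset.mem_product, mem_sourcePaths, mem_sinkPaths, Prod.exists]
    constructor
    · rintro ⟨p, hp, rfl⟩
      obtain ⟨l₁, l₂, h, h1, h2⟩ := p.exists_split_at hp
      exact ⟨l₁, l₂, ⟨⟨_, p.isSource, h1⟩, ⟨_, p.isSink, h2⟩⟩, h.symm⟩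
    · rintro ⟨l₁, l₂, ⟨⟨u, hu, h1⟩, ⟨w, hw, h2⟩⟩, rfl⟩
      exact ⟨⟨u, l₁ ++ e :: l₂, w, isPath_append_cons_iff.2 ⟨h1, h2⟩, hu, hw⟩, by simp, rfl⟩
  have h3 : ∑ p : G.Route with e ∈ p.edges, 𝓕.pathWeight F p.edges =
      ∑ l ∈ (Finset.univ.filter fun p : G.Route => e ∈ p.edges).image Route.edges,
        𝓕.pathWeight F l := by
    rw [Finset.sum_image]
    intro p hp q hq h
    have hp : e ∈ p.edges := by simpa using hp
    exact Route.edges_injective_of_ne_nil (List.ne_nil_of_mem hp) h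
  rw [h1, h3, h2, Finset.sum_image, Finset.sum_product]
  · simp only [pathWeight_append_cons]
    have key : ∀ l ∈ sourcePaths hG (G.tail e), ∑ l' ∈ sinkPaths hG (G.head e),
        (𝓕.push F e l' (𝓕.height F F l e) - 𝓕.push F e l' (𝓕.height F 0 l e)) =
        𝓕.height F F l e - 𝓕.height F 0 l e := by
      intro l _
      have h1 := height_zero_nonneg (𝓕 := 𝓕) h0 l e
      have h2 := height_zero_le (𝓕 := 𝓕) h0 l e
      have h3 := height_self_le (𝓕 := 𝓕) h0 l e
      exact sum_push_sub h0 hcons hG e (h1.trans h2) h3 h1 (h2.trans h3)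
    rw [Finset.sum_congr rfl key]
    simpa using sum_height_telescope (𝓕 := 𝓕) h0 hcons hG e id
  · rintro ⟨l₁, l₂⟩ hl ⟨l₁', l₂'⟩ - h
    simp only [Finset.coe_product, Set.mem_prod, Finset.mem_coe, mem_sourcePaths,
      mem_sinkPaths] at hl h
    obtain ⟨⟨u, hu, h1⟩, ⟨w, hw, h2⟩⟩ := hl
    obtain ⟨rfl, rfl⟩ := Route.append_cons_inj hG
      ⟨u, l₁ ++ e :: l₂, w, isPath_append_cons_iff.2 ⟨h1, h2⟩, hu, hw⟩ rfl h
    rfl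

/-! ### Integrality of the stacked weights -/

theorem exists_int_push (hF : ∀ e, ∃ n : ℤ, F e = n) (e : E) (l : List E) {t : ℝ}
    (ht : ∃ n : ℤ, t = n) : ∃ n : ℤ, 𝓕.push F e l t = n := by
  classical
  choose N hN using hF
  induction l generalizing e t with
  | nil => exact ht
  | cons f l ih =>
    refine ih f ?_
    obtain ⟨n, rfl⟩ := ht
    refine ⟨min ((∑ f with G.head f = G.head e ∧ 𝓕.inLt (G.head e) f e, N f) + n)
        ((∑ g with G.tail g = G.tail f ∧ 𝓕.outLt (G.tail f) g f, N g) + N f) -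
      min ((∑ f with G.head f = G.head e ∧ 𝓕.inLt (G.head e) f e, N f) + n)
        (∑ g with G.tail g = G.tail f ∧ 𝓕.outLt (G.tail f) g f, N g), ?_⟩
    simp only [step, inBase, outBase, hN]
    push_cast
    rfl

theorem exists_int_pathWeight (hF : ∀ e, ∃ n : ℤ, F e = n) (l : List E) :
    ∃ n : ℤ, 𝓕.pathWeight F l = n := by
  cases l with
  | nil => exact ⟨0, by simp [pathWeight]⟩
  | cons e l =>
    obtain ⟨m, hm⟩ := exists_int_push (𝓕 := 𝓕) hF e l (hF e)
    obtain ⟨n, hn⟩ := exists_int_push (𝓕 := 𝓕) hF e l (t := 0) ⟨0, by simp⟩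
    exact ⟨m - n, by simp [pathWeight, hm, hn]⟩

end Framing

end DiMultigraph

/-! ### Uniqueness of the route weights on a clique -/

namespace DiMultigraph

variable {V E : Type*} {G : DiMultigraph V E}

/-- The routes through `e` whose part before `e` satisfies `Q`. -/
def routesThrough (Q : List E → Prop) (e : E) : Set G.Route :=
  {p | ∃ l₁ l₂, p.edges = l₁ ++ e :: l₂ ∧ Q l₁}

/-- In a clique, a down-set for the order before a vertex and a down-set for the order of the
edges leaving it are nested. -/
theorem Framing.IsRouteClique.nested {𝓕 : G.Framing} {R : Set G.Route} (hR : 𝓕.IsRouteClique R) {e e' : E}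
    (hv : G.head e = G.tail e') {Q : List E → Prop}
    (hQ : ∀ u₁ u₂ l₁ l₂, G.IsSource u₁ → G.IsSource u₂ → G.IsPath u₁ l₁ (G.tail e) →
      G.IsPath u₂ l₂ (G.tail e) → Q l₁ → ¬ Q l₂ → 𝓕.PreLt l₁ l₂)
    {D : E → Prop} (hD : ∀ f g, G.tail f = G.tail e' → G.tail g = G.tail e' → D g → ¬ D f →
      𝓕.outLt (G.tail e') g f)
    {p q : G.Route} (hp : p ∈ R) (hq : q ∈ R)
    (hpA : p ∈ {p : G.Route | ∃ f, (G.head f = G.head e ∧ 𝓕.inLt (G.head e) f e) ∧ f ∈ p.edges} ∪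
      routesThrough Q e)
    (hpB : p ∉ {p : G.Route | ∃ f, (G.tail f = G.tail e' ∧ D f) ∧ f ∈ p.edges})
    (hqB : q ∈ {p : G.Route | ∃ f, (G.tail f = G.tail e' ∧ D f) ∧ f ∈ p.edges}) :
    q ∈ {p : G.Route | ∃ f, (G.head f = G.head e ∧ 𝓕.inLt (G.head e) f e) ∧ f ∈ p.edges} ∪
      routesThrough Q e := by
  by_contra hqA
  have hinn := isInternal_of_head_eq_tail hv
  have hpq : p ≠ q := fun h => hqA (h ▸ hpA)
  obtain ⟨f, l₁, l₂, hpe, hfv, hf⟩ : ∃ f l₁ l₂, p.edges = l₁ ++ f :: l₂ ∧ G.head f = G.head e ∧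
      (𝓕.inLt (G.head e) f e ∨ f = e ∧ Q l₁) := by
    rcases hpA with ⟨f, ⟨hf, hlt⟩, hfp⟩ | ⟨l₁, l₂, h, hQl⟩
    · obtain ⟨l₁, l₂, h, -⟩ := p.exists_split_at hfp
      exact ⟨f, l₁, l₂, h, hf, Or.inl hlt⟩
    · exact ⟨e, l₁, l₂, h, rfl, Or.inr ⟨rfl, hQl⟩⟩
  have hpp := p.isPath
  rw [hpe, isPath_append_cons_iff] at hpp
  obtain ⟨hl₁, hl₂⟩ := hpp
  cases l₂ with
  | nil =>
    have := isPath_nil_iff.1 hl₂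
    exact hinn.2 (hfv ▸ this ▸ p.isSink)
  | cons f' l₂ =>
  have hf'v : G.tail f' = G.tail e' := by rw [(isPath_cons_iff.1 hl₂).1, hfv, hv]
  have hf'D : ¬ D f' := fun h => hpB ⟨f', ⟨hf'v, h⟩, by simp [hpe]⟩
  obtain ⟨g', ⟨hg'v, hg'D⟩, hg'q⟩ := hqB
  obtain ⟨m₁, m₂, hqe, hm₁, hm₂⟩ := q.exists_split_at hg'q
  rcases List.eq_nil_or_concat m₁ with rfl | ⟨m₁, g, rfl⟩
  · have := isPath_nil_iff.1 hm₁
    exact hinn.1 (hv ▸ hg'v ▸ this ▸ q.isSource)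
  simp only [List.concat_eq_append] at *
  obtain ⟨hm₁', hgv⟩ := isPath_snoc_iff.1 hm₁
  rw [hg'v, ← hv] at hgv
  have hge : ¬ 𝓕.inLt (G.head e) g e := fun h => hqA (Or.inl ⟨g, ⟨hgv, h⟩, by simp [hqe]⟩)
  have hgQ : g = e → ¬ Q m₁ := by
    rintro rfl h
    exact hqA (Or.inr ⟨m₁, g' :: m₂, by simp [hqe], h⟩)
  -- If `q` is not in the incoming down-set, it enters after `p`; yet it leaves inside `D` while `p`
  -- leaves outside, so the two are incompatible at this vertex.
  have hpre : 𝓕.PreLt (l₁ ++ [f]) (m₁ ++ [g]) := by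
    rw [𝓕.preLt_snoc_iff, hfv]
    by_cases h : g = e
    · subst h
      rcases hf with hf | ⟨rfl, hf⟩
      · exact Or.inl hf
      · exact Or.inr ⟨rfl, hQ _ _ _ _ p.isSource q.isSource hl₁ hm₁' hf (hgQ rfl)⟩
    · have := (𝓕.inLt_total' hinn hgv rfl h).resolve_left hge
      rcases hf with hf | ⟨rfl, hf⟩
      · exact Or.inl (𝓕.inLt_trans hinn hfv rfl hgv hf this)
      · exact Or.inl this
  have hpost : 𝓕.PostLt (g' :: m₂) (f' :: l₂) :=
    𝓕.postLt_cons_iff.2 (Or.inl (hg'v ▸ hD f' g' hf'v hg'v hg'D hf'D))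
  refine (hR hp hq hpq (G.head e)).1 ⟨l₁ ++ [f], f' :: l₂, m₁ ++ [g], g' :: m₂, by simp [hpe],
    isPath_snoc_iff.2 ⟨hl₁, hfv⟩, hfv ▸ hl₂, by simp [hqe], isPath_snoc_iff.2 ⟨hm₁', hgv⟩,
    isPath_cons_iff.2 ⟨by rw [hg'v, hv], hm₂⟩, hpre, hpost⟩

variable [Fintype G.Route]

open Classical in
/-- The total weight of a set of routes. -/
noncomputable def routeMass (w : G.Route → ℝ) (A : Set G.Route) : ℝ := ∑ p with p ∈ A, w p

theorem routeMass_congr {w : G.Route → ℝ} {A B : Set G.Route}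
    (h : ∀ p, w p ≠ 0 → (p ∈ A ↔ p ∈ B)) : routeMass w A = routeMass w B := by
  classical
  rw [routeMass, routeMass, Finset.sum_filter, Finset.sum_filter]
  refine Finset.sum_congr rfl fun p _ => ?_
  by_cases hp : w p = 0
  · simp [hp]
  · simp [h p hp]

theorem routeMass_mono {w : G.Route → ℝ} (hw : ∀ p, 0 ≤ w p) {A B : Set G.Route} (h : A ⊆ B) :
    routeMass w A ≤ routeMass w B := by
  classical
  exact Finset.sum_le_sum_of_subset_of_nonneg
    (fun p hp => by simpa using h (by simpa using hp)) fun _ _ _ => hw _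

theorem routeMass_union {w : G.Route → ℝ} {A B : Set G.Route} (h : Disjoint A B) :
    routeMass w (A ∪ B) = routeMass w A + routeMass w B := by
  classical
  rw [routeMass, routeMass, routeMass, ← Finset.sum_union]
  · congr 1
    ext p
    simp
  · refine Finset.disjoint_left.2 fun p hp hq => ?_
    exact Set.disjoint_left.1 h (by simpa using hp : p ∈ A) (by simpa using hq)

/-- The mass of the intersection of two sets that are nested on the support. -/
theorem routeMass_inter_eq_min {w : G.Route → ℝ} (hw : ∀ p, 0 ≤ w p) {A B : Set G.Route}
    (h : ∀ p q, w p ≠ 0 → w q ≠ 0 → p ∈ A → p ∉ B → q ∈ B → q ∈ A) :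
    routeMass w (A ∩ B) = min (routeMass w A) (routeMass w B) := by
  by_cases hp : ∃ p, w p ≠ 0 ∧ p ∈ A ∧ p ∉ B
  · obtain ⟨p, hp0, hpA, hpB⟩ := hp
    have h1 : routeMass w (A ∩ B) = routeMass w B :=
      routeMass_congr fun q hq => ⟨fun h => h.2, fun hB => ⟨h p q hp0 hq hpA hpB hB, hB⟩⟩
    rw [min_eq_right, h1]
    rw [← h1]
    exact routeMass_mono hw Set.inter_subset_left
  · push Not at hp
    have h1 : routeMass w (A ∩ B) = routeMass w A :=
      routeMass_congr fun q hq => ⟨fun h => h.1, fun hA => ⟨hA, hp q hq hA⟩⟩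
    rw [min_eq_left, h1]
    rw [← h1]
    exact routeMass_mono hw Set.inter_subset_right

theorem sum_smul_indicator_apply (w : G.Route → ℝ) (e : E) :
    (∑ p : G.Route, w p • p.indicator) e = routeMass w {p | e ∈ p.edges} := by
  classical
  simp [Finset.sum_apply, Route.indicator, routeMass, Finset.sum_filter]

theorem routeMass_exists_mem {w : G.Route → ℝ} (S : Finset E)
    (hS : ∀ p : G.Route, ∀ e ∈ S, ∀ f ∈ S, e ∈ p.edges → f ∈ p.edges → e = f) :
    routeMass w {p | ∃ f ∈ S, f ∈ p.edges} = ∑ f ∈ S, routeMass w {p | f ∈ p.edges} := by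
  classical
  simp only [routeMass, Finset.sum_filter]
  rw [Finset.sum_comm]
  refine Finset.sum_congr rfl fun p _ => ?_
  by_cases h : ∃ f ∈ S, f ∈ p.edges
  · obtain ⟨f, hf, hfp⟩ := h
    rw [Finset.sum_eq_single f]
    · rw [if_pos (show p ∈ {p : G.Route | ∃ f ∈ S, f ∈ p.edges} from ⟨f, hf, hfp⟩),
        if_pos (show p ∈ {p : G.Route | f ∈ p.edges} from hfp)]
    · intro g hg hne
      exact if_neg fun hgp => hne (hS p g hg f hf hgp hfp)
    · exact fun h => absurd hf h
  · rw [if_neg (show p ∉ {p : G.Route | ∃ f ∈ S, f ∈ p.edges} from h)]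
    exact (Finset.sum_eq_zero fun f hf => if_neg fun hfp => h ⟨f, hf, hfp⟩).symm

namespace Framing

variable {𝓕 : G.Framing}

variable [Fintype E] {F : E → ℝ} {w : G.Route → ℝ}

/-- Masses of down-sets obey the recursion that defines `height`. Let `A` be the routes entering the
vertex within the down-set given by `Q`, and let `B D₁`, `B D₂` be those leaving strictly before
`e'`, or up to and including `e'`. Nestedness turns the masses of `A ∩ B D₁` and `A ∩ B D₂` into
minima, whose difference is `step`. -/
theorem routeMass_routesThrough_snoc (hG : G.IsAcyclic) (hw : ∀ p, 0 ≤ w p)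
    (hR : 𝓕.IsRouteClique {p | w p ≠ 0}) (hF : ∀ e, routeMass w {p | e ∈ p.edges} = F e)
    {e e' : E} (hv : G.head e = G.tail e') {Q Q' : List E → Prop}
    (hQ : ∀ u₁ u₂ l₁ l₂, G.IsSource u₁ → G.IsSource u₂ → G.IsPath u₁ l₁ (G.tail e) →
      G.IsPath u₂ l₂ (G.tail e) → Q l₁ → ¬ Q l₂ → 𝓕.PreLt l₁ l₂)
    (hQ' : ∀ l f, G.head f = G.head e →
      (Q' (l ++ [f]) ↔ 𝓕.inLt (G.head e) f e ∨ f = e ∧ Q l)) :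
    routeMass w (routesThrough Q' e') = 𝓕.step F e e' (routeMass w (routesThrough Q e)) := by
  classical
  have hinn := isInternal_of_head_eq_tail hv
  set A : Set G.Route :=
    {p : G.Route | ∃ f, (G.head f = G.head e ∧ 𝓕.inLt (G.head e) f e) ∧ f ∈ p.edges} ∪
      routesThrough Q e with hA
  let B : (E → Prop) → Set G.Route := fun D =>
    {p : G.Route | ∃ f, (G.tail f = G.tail e' ∧ D f) ∧ f ∈ p.edges}
  let D₁ : E → Prop := fun f => 𝓕.outLt (G.tail e') f e'
  let D₂ : E → Prop := fun f => f = e' ∨ 𝓕.outLt (G.tail e') f e'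
  have hmassA : routeMass w A = 𝓕.inBase F e + routeMass w (routesThrough Q e) := by
    rw [hA, routeMass_union]
    · congr 1
      have := routeMass_exists_mem (w := w)
        (Finset.univ.filter fun f => G.head f = G.head e ∧ 𝓕.inLt (G.head e) f e) (by
          intro p f hf g hg hfp hgp
          simp only [Finset.mem_filter, Finset.mem_univ, true_and] at hf hg
          exact p.eq_of_head_eq hG hfp hgp (hf.1.trans hg.1.symm))
      simp only [Finset.mem_filter, Finset.mem_univ, true_and, hF] at this
      exact this
    · refine Set.disjoint_left.2 ?_
      rintro p ⟨f, ⟨hf, hlt⟩, hfp⟩ ⟨l₁, l₂, h, -⟩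
      obtain rfl := p.eq_of_head_eq hG hfp (by simp [h] : e ∈ p.edges) hf
      exact 𝓕.inLt_irrefl hinn rfl hlt
  have hmassB : ∀ D : E → Prop, routeMass w (B D) =
      ∑ f with G.tail f = G.tail e' ∧ D f, F f := by
    intro D
    have := routeMass_exists_mem (w := w)
      (Finset.univ.filter fun f => G.tail f = G.tail e' ∧ D f) (by
        intro p f hf g hg hfp hgp
        simp only [Finset.mem_filter, Finset.mem_univ, true_and] at hf hg
        exact p.eq_of_tail_eq hG hfp hgp (hf.1.trans hg.1.symm))
    simp only [Finset.mem_filter, Finset.mem_univ, true_and, hF] at this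
    exact this
  have hmass₁ : routeMass w (B D₁) = 𝓕.outBase F e' := hmassB D₁
  have hmass₂ : routeMass w (B D₂) = 𝓕.outBase F e' + F e' := by
    rw [hmassB D₂, outBase, add_comm, ← Finset.sum_insert (s := Finset.univ.filter _)]
    · refine Finset.sum_congr ?_ fun _ _ => rfl
      ext f
      simp only [Finset.mem_filter, Finset.mem_univ, true_and, Finset.mem_insert, D₂]
      constructor
      · rintro ⟨h, h' | h'⟩
        exacts [Or.inl h', Or.inr ⟨h, h'⟩]
      · rintro (rfl | ⟨h, h'⟩)
        exacts [⟨rfl, Or.inl rfl⟩, ⟨h, Or.inr h'⟩]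
    · simp [𝓕.outLt_irrefl e']
  have hmin : ∀ D : E → Prop, (∀ f g, G.tail f = G.tail e' → G.tail g = G.tail e' → D g → ¬ D f →
      𝓕.outLt (G.tail e') g f) →
      routeMass w (A ∩ B D) = min (routeMass w A) (routeMass w (B D)) := fun D hD =>
    routeMass_inter_eq_min hw fun p q hp hq hpA hpB hqB =>
      hR.nested hv hQ hD hp hq hpA hpB hqB
  have hmin₁ := hmin D₁ fun f g hf hg hgD hfD => by
    by_cases h : f = e'
    · subst h
      exact hgD
    · exact 𝓕.outLt_trans hg rfl hf hgD ((𝓕.outLt_total' hf rfl h).resolve_left hfD)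
  have hmin₂ := hmin D₂ fun f g hf hg hgD hfD => by
    simp only [D₂, not_or] at hfD hgD
    have := (𝓕.outLt_total' hf rfl hfD.1).resolve_left hfD.2
    rcases hgD with rfl | hgD
    · exact this
    · exact 𝓕.outLt_trans hg rfl hf hgD this
  -- Passing from `D₁` to `D₂` adds exactly the routes of `A` that leave by `e'`, and by `hQ'` their
  -- initial parts are the ones satisfying `Q'`.
  have hsplit : A ∩ B D₂ = (A ∩ B D₁) ∪ routesThrough Q' e' := by
    ext p
    constructor
    · rintro ⟨hpA, f, ⟨hf, h | h⟩, hfp⟩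
      · subst h
        right
        obtain ⟨m, l₂, hpe, hm, -⟩ := p.exists_split_at hfp
        rcases List.eq_nil_or_concat m with rfl | ⟨l₁, g, rfl⟩
        · have := isPath_nil_iff.1 hm
          exact absurd (hv ▸ this ▸ p.isSource) hinn.1
        simp only [List.concat_eq_append] at *
        obtain ⟨hl₁, hgv⟩ := isPath_snoc_iff.1 hm
        rw [← hv] at hgv
        refine ⟨l₁ ++ [g], l₂, hpe, (hQ' l₁ g hgv).2 ?_⟩
        have hgp : g ∈ p.edges := by simp [hpe]
        rcases hpA with ⟨g', ⟨hg', hlt⟩, hg'p⟩ | ⟨m₁, m₂, hm, hQm⟩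
        · obtain rfl := p.eq_of_head_eq hG hgp hg'p (hgv.trans hg'.symm)
          exact Or.inl hlt
        · obtain rfl := p.eq_of_head_eq hG hgp (by simp [hm] : e ∈ p.edges) hgv
          right
          obtain ⟨rfl, -⟩ := p.append_cons_inj hG hm (by simpa using hpe)
          exact ⟨rfl, hQm⟩
      · exact Or.inl ⟨hpA, f, ⟨hf, h⟩, hfp⟩
    · rintro (⟨hpA, f, ⟨hf, h⟩, hfp⟩ | ⟨m, l₂, hpe, hQm⟩)
      · exact ⟨hpA, f, ⟨hf, Or.inr h⟩, hfp⟩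
      · refine ⟨?_, e', ⟨rfl, Or.inl rfl⟩, by simp [hpe]⟩
        have hpp := p.isPath
        rw [hpe] at hpp
        have hm := (isPath_append_cons_iff.1 hpp).1
        rcases List.eq_nil_or_concat m with rfl | ⟨l₁, g, rfl⟩
        · have := isPath_nil_iff.1 hm
          exact absurd (hv ▸ this ▸ p.isSource) hinn.1
        simp only [List.concat_eq_append] at *
        obtain ⟨hl₁, hgv⟩ := isPath_snoc_iff.1 hm
        rw [← hv] at hgv
        rcases (hQ' l₁ g hgv).1 hQm with h | ⟨rfl, h⟩
        · exact Or.inl ⟨g, ⟨hgv, h⟩, by simp [hpe]⟩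
        · exact Or.inr ⟨l₁, e' :: l₂, by simp [hpe], h⟩
  have hdisj : Disjoint (A ∩ B D₁) (routesThrough Q' e') := by
    refine Set.disjoint_left.2 ?_
    rintro p ⟨-, f, ⟨hf, h⟩, hfp⟩ ⟨m, l₂, hpe, -⟩
    obtain rfl := p.eq_of_tail_eq hG hfp (by simp [hpe] : e' ∈ p.edges) hf
    exact 𝓕.outLt_irrefl f h
  have := routeMass_union (w := w) hdisj
  rw [← hsplit, hmin₁, hmin₂, hmass₁, hmass₂, hmassA] at this
  rw [step]
  linarith

/-- The closed and open down-sets of `σ` are the two ends of its interval in `e`. At a source the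
empty path is the only path, so they have mass `F e` and `0`; each further edge is one application
of the recursion. -/
theorem routeMass_prefix_eq_height (hG : G.IsAcyclic) (hw : ∀ p, 0 ≤ w p)
    (hR : 𝓕.IsRouteClique {p | w p ≠ 0}) (hF : ∀ e, routeMass w {p | e ∈ p.edges} = F e)
    {u : V} (hu : G.IsSource u) {σ : List E} {e : E} (hσ : G.IsPath u σ (G.tail e)) :
    routeMass w (routesThrough (fun l => l = σ ∨ 𝓕.PreLt l σ) e) = 𝓕.height F F σ e ∧
      routeMass w (routesThrough (fun l => 𝓕.PreLt l σ) e) = 𝓕.height F 0 σ e := by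
  classical
  induction σ using List.reverseRecOn generalizing e with
  | nil =>
    have hs : G.IsSource (G.tail e) := isPath_nil_iff.1 hσ ▸ hu
    constructor
    · rw [height, ← hF e]
      refine routeMass_congr fun p _ => ?_
      constructor
      · rintro ⟨l₁, l₂, h, -⟩
        simp [h]
      · intro hp
        obtain ⟨l₁, l₂, h, h1, -⟩ := p.exists_split_at hp
        exact ⟨l₁, l₂, h, Or.inl (hs.eq_nil_of_isPath h1)⟩
    · have : routesThrough (G := G) (fun l => 𝓕.PreLt l []) e = ∅ := by
        ext p
        simp [routesThrough, 𝓕.not_preLt_nil_right]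
      simp [this, routeMass, height]
  | append_singleton σ f ih =>
    obtain ⟨hσ', hf⟩ := isPath_snoc_iff.1 hσ
    obtain ⟨h1, h2⟩ := ih hσ'
    have hns := not_isSink_tail (G := G) f
    constructor
    · rw [height_snoc, ← h1]
      refine routeMass_routesThrough_snoc hG hw hR hF hf ?_ ?_
      · intro u₁ u₂ l₁ l₂ hu₁ hu₂ hl₁ hl₂ hle hnle
        rw [not_or] at hnle
        have hlt := (𝓕.preLt_total hns hl₂ hu₂ hσ' hu hnle.1).resolve_left hnle.2
        rcases hle with rfl | hle
        · exact hlt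
        · exact 𝓕.preLt_trans hns hl₁ hσ' hl₂ hle hlt
      · intro l g hg
        simp only [preLt_snoc_iff, hg]
        constructor
        · rintro (h | h | ⟨rfl, h⟩)
          · obtain ⟨rfl, rfl⟩ : l = σ ∧ g = f := by simpa using List.append_inj' h rfl
            exact Or.inr ⟨rfl, Or.inl rfl⟩
          · exact Or.inl h
          · exact Or.inr ⟨rfl, Or.inr h⟩
        · rintro (h | ⟨rfl, rfl | h⟩)
          · exact Or.inr (Or.inl h)
          · exact Or.inl rfl
          · exact Or.inr (Or.inr ⟨rfl, h⟩)
    · rw [height_snoc, ← h2]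
      refine routeMass_routesThrough_snoc hG hw hR hF hf ?_ ?_
      · intro u₁ u₂ l₁ l₂ hu₁ hu₂ hl₁ hl₂ hlt hnlt
        by_cases h : l₂ = σ
        · exact h ▸ hlt
        · exact 𝓕.preLt_trans hns hl₁ hσ' hl₂ hlt
            ((𝓕.preLt_total hns hl₂ hu₂ hσ' hu h).resolve_left hnlt)
      · intro l g hg
        simp only [preLt_snoc_iff, hg]

/-- The weights of a decomposition supported on a clique are determined by the flow. -/
theorem eq_pathWeight_of_isRouteClique (hG : G.IsAcyclic) (hw : ∀ p, 0 ≤ w p)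
    (hR : 𝓕.IsRouteClique {p | w p ≠ 0}) (hF : ∑ p : G.Route, w p • p.indicator = F)
    (p : G.Route) (hp : p.edges ≠ []) : w p = 𝓕.pathWeight F p.edges := by
  classical
  have hF' : ∀ e, routeMass w {p | e ∈ p.edges} = F e := fun e => by
    rw [← sum_smul_indicator_apply, hF]
  obtain ⟨σ, e, hpe⟩ := (List.eq_nil_or_concat p.edges).resolve_left hp
  rw [List.concat_eq_append] at hpe
  have hpp := p.isPath
  rw [hpe, isPath_snoc_iff] at hpp
  obtain ⟨hσ, he⟩ := hpp
  have hsink : G.IsSink (G.head e) := he ▸ p.isSink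
  obtain ⟨h1, h2⟩ := routeMass_prefix_eq_height hG hw hR hF' p.isSource hσ
  rw [hpe, pathWeight_append_cons, push, push, ← h1, ← h2]
  -- The last edge ends in a sink, so a route that reaches it along `σ` is `p` itself. Hence the two
  -- down-sets differ by `p` alone.
  have hunion : routesThrough (fun l => l = σ ∨ 𝓕.PreLt l σ) e =
      {p} ∪ routesThrough (G := G) (fun l => 𝓕.PreLt l σ) e := by
    ext q
    constructor
    · rintro ⟨l₁, l₂, hq, rfl | h⟩
      · left
        have hqq := q.isPath
        rw [hq, isPath_append_cons_iff] at hqq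
        obtain rfl := hsink.eq_nil_of_isPath hqq.2
        exact (Route.edges_injective_of_ne_nil hp (hpe.trans hq.symm)).symm
      · exact Or.inr ⟨l₁, l₂, hq, h⟩
    · rintro (rfl | ⟨l₁, l₂, hq, h⟩)
      · exact ⟨σ, [], hpe, Or.inl rfl⟩
      · exact ⟨l₁, l₂, hq, Or.inr h⟩
  rw [hunion, routeMass_union]
  · simp [routeMass, Finset.sum_filter]
  · refine Set.disjoint_left.2 ?_
    rintro q rfl ⟨l₁, l₂, hq, h⟩
    obtain ⟨rfl, -⟩ := q.append_cons_inj hG hpe hq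
    exact 𝓕.preLt_irrefl hσ (not_isSink_tail e) h

end Framing

end DiMultigraph

/-! ### The total order on layerings -/

namespace DiMultigraph

variable {V E : Type*} {G : DiMultigraph V E} {a : V → ℤ}

theorem IsLayering.exists_mem_src {L : Finset G.Route} (hL : G.IsLayering a L) {i : V}
    (hi : G.IsSource i) : ∃ p ∈ L, p.src = i := by
  classical
  have : (L.filter fun p => p.src = i).Nonempty := by
    rw [← Finset.card_pos]
    have := hL.source i hi
    convert Nat.one_pos
  obtain ⟨p, hp⟩ := this
  exact ⟨p, Finset.mem_filter.1 hp⟩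

theorem IsLayering.eq_of_src_eq {L : Finset G.Route} (hL : G.IsLayering a L) {p q : G.Route}
    (hp : p ∈ L) (hq : q ∈ L) (h : p.src = q.src) : p = q := by
  classical
  have := hL.source q.src q.isSource
  exact Finset.card_le_one.1 this.le p (Finset.mem_filter.2 ⟨hp, h⟩) q
    (Finset.mem_filter.2 ⟨hq, rfl⟩)

namespace Framing

variable {𝓕 : G.Framing}

theorem layeringLt_irrefl {L : Finset G.Route} (hL : G.IsLayering a L) : ¬ 𝓕.LayeringLt L L := by
  rintro ⟨p, hp, q, hq, hpq, hlt, -⟩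
  rw [hL.eq_of_src_eq hp hq hpq] at hlt
  exact 𝓕.postLt_irrefl _ hlt

/-- The comparison of `L` and `N` is decided at the larger of the two sources that decide the given
comparisons; above it all three layerings agree. -/
theorem layeringLt_trans {L M N : Finset G.Route} (hL : G.IsLayering a L)
    (hM : G.IsLayering a M) (hN : G.IsLayering a N) (h : 𝓕.LayeringLt L M)
    (h' : 𝓕.LayeringLt M N) : 𝓕.LayeringLt L N := by
  obtain ⟨p, hp, q, hq, hpq, hlt, habove⟩ := h
  obtain ⟨q', hq', r, hr, hqr, hlt', habove'⟩ := h'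
  have hagree : ∀ p' ∈ L, ∀ r' ∈ N, p'.src = r'.src → 𝓕.srcLt p.src p'.src →
      𝓕.srcLt q'.src p'.src → p' = r' := by
    intro p' hp' r' hr' hsrc h1 h2
    obtain ⟨m, hm, hms⟩ := hM.exists_mem_src p'.isSource
    rw [habove p' hp' m hm hms.symm h1]
    exact habove' m hm r' hr' (hms.trans hsrc) (hms ▸ h2)
  by_cases hsrc : p.src = q'.src
  · obtain rfl := hM.eq_of_src_eq hq hq' (hpq ▸ hsrc)
    refine ⟨p, hp, r, hr, hpq.trans hqr, ?_, fun p' hp' r' hr' hs h1 =>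
      hagree p' hp' r' hr' hs h1 (hsrc ▸ h1)⟩
    have hq'' : G.IsPath p.src q.edges q.snk := hpq ▸ q.isPath
    have hr' : G.IsPath p.src r.edges r.snk := (hpq.trans hqr) ▸ r.isPath
    exact 𝓕.postLt_trans p.isPath hq'' hr' hlt hlt'
  · rcases 𝓕.srcLt_total' p.isSource q'.isSource hsrc with h | h
    · obtain ⟨p', hp', hs⟩ := hL.exists_mem_src q'.isSource
      obtain rfl := habove p' hp' q' hq' hs (hs ▸ h)
      exact ⟨p', hp', r, hr, hqr, hlt', fun p'' hp'' r' hr' hs h1 => hagree p'' hp'' r' hr' hs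
        (𝓕.srcLt_trans p.isSource p'.isSource p''.isSource h h1) h1⟩
    · obtain ⟨r', hr', hs⟩ := hN.exists_mem_src q.isSource
      obtain rfl := habove' q hq r' hr' hs.symm (hpq ▸ h)
      exact ⟨p, hp, q, hr', hpq, hlt, fun p'' hp'' r' hr' hs h1 => hagree p'' hp'' r' hr' hs h1
        (𝓕.srcLt_trans q'.isSource p.isSource p''.isSource h h1)⟩

theorem layeringLt_asymm {L M : Finset G.Route} (hL : G.IsLayering a L)
    (hM : G.IsLayering a M) (h : 𝓕.LayeringLt L M) : ¬ 𝓕.LayeringLt M L :=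
  fun h' => layeringLt_irrefl hL (layeringLt_trans hL hM hL h h')

theorem layeringLt_total [Finite V] {L M : Finset G.Route} (hL : G.IsLayering a L)
    (hM : G.IsLayering a M) (hne : L ≠ M) : 𝓕.LayeringLt L M ∨ 𝓕.LayeringLt M L := by
  classical
  have := Fintype.ofFinite V
  let S : Finset V := Finset.univ.filter fun i =>
    G.IsSource i ∧ ∃ p ∈ L, ∃ q ∈ M, p.src = i ∧ q.src = i ∧ p ≠ q
  have hmemS : ∀ i, i ∈ S ↔ G.IsSource i ∧ ∃ p ∈ L, ∃ q ∈ M, p.src = i ∧ q.src = i ∧ p ≠ q := by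
    simp [S]
  have hS : S.Nonempty := by
    by_contra hS
    have hagree : ∀ p ∈ L, ∀ q ∈ M, p.src = q.src → p = q := by
      intro p hp q hq h
      by_contra hpq
      exact hS ⟨p.src, (hmemS _).2 ⟨p.isSource, p, hp, q, hq, rfl, h.symm, hpq⟩⟩
    refine hne (Finset.Subset.antisymm (fun p hp => ?_) fun q hq => ?_)
    · obtain ⟨q, hq, h⟩ := hM.exists_mem_src p.isSource
      exact hagree p hp q hq h.symm ▸ hq
    · obtain ⟨p, hp, h⟩ := hL.exists_mem_src q.isSource
      exact hagree p hp q hq h ▸ hp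
  obtain ⟨i, hi, hmax⟩ := Finset.exists_greatest_of_total (r := 𝓕.srcLt) (S := S)
    (fun u hu v hv w hw => 𝓕.srcLt_trans ((hmemS u).1 hu).1 ((hmemS v).1 hv).1 ((hmemS w).1 hw).1)
    (fun u hu v hv => 𝓕.srcLt_total' ((hmemS u).1 hu).1 ((hmemS v).1 hv).1) hS
  obtain ⟨hsrc, p, hp, q, hq, hpi, hqi, hpq⟩ := (hmemS i).1 hi
  have habove : ∀ p' ∈ L, ∀ q' ∈ M, p'.src = q'.src → 𝓕.srcLt i p'.src → p' = q' := by
    intro p' hp' q' hq' hs hlt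
    by_contra hne
    rcases hmax p'.src ((hmemS _).2 ⟨p'.isSource, p', hp', q', hq', rfl, hs.symm, hne⟩) with h | h
    · exact 𝓕.srcLt_irrefl hsrc (h ▸ hlt)
    · exact 𝓕.srcLt_irrefl hsrc (𝓕.srcLt_trans hsrc p'.isSource hsrc hlt h)
  have hsrcs : p.src = q.src := hpi.trans hqi.symm
  have hedges : p.edges ≠ q.edges := by
    intro h
    refine hpq (Route.ext hsrcs h (p.isPath.finish_unique ?_))
    rw [hsrcs, h]
    exact q.isPath
  have hq' : G.IsPath p.src q.edges q.snk := hsrcs ▸ q.isPath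
  rcases 𝓕.postLt_total p.isPath p.isSink hq' q.isSink hedges with h | h
  · exact Or.inl ⟨p, hp, q, hq, hsrcs, h, hpi ▸ habove⟩
  · refine Or.inr ⟨q, hq, p, hp, hsrcs.symm, h, fun q' hq' p' hp' hs hlt => ?_⟩
    exact (habove p' hp' q' hq' hs.symm (hqi ▸ hs ▸ hlt)).symm

theorem exists_min_layering [Finite V] {S : Finset (Finset G.Route)}
    (hS : ∀ L ∈ S, G.IsLayering a L) (hne : S.Nonempty) :
    ∃ L ∈ S, ∀ M ∈ S, L = M ∨ 𝓕.LayeringLt L M := by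
  obtain ⟨L, hL, hmin⟩ := Finset.exists_greatest_of_total (r := fun L M => 𝓕.LayeringLt M L)
    (fun L hL M hM N hN h h' => layeringLt_trans (hS N hN) (hS M hM) (hS L hL) h' h)
    (fun L hL M hM h => (layeringLt_total (hS L hL) (hS M hM) h).symm) hne
  exact ⟨L, hL, fun M hM => (hmin M hM).imp_left Eq.symm⟩

end Framing

/-! ### Balanced weights and layerings in their support -/

/-- A weight on routes with total `x` at each source and total `x * |a j|` at each sink `j`. -/
structure IsBalanced [Fintype G.Route] (a : V → ℤ) (x : ℝ) (w : G.Route → ℝ) : Prop where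
  nonneg : ∀ p, 0 ≤ w p
  source : ∀ i, G.IsSource i → routeMass w {p | p.src = i} = x
  sink : ∀ j, G.IsSink j → routeMass w {p | p.snk = j} = x * (a j).natAbs

theorem routeMass_fiber [Fintype G.Route] {κ : Type*} [DecidableEq κ] (w : G.Route → ℝ)
    (g : G.Route → κ) (s : Finset κ) :
    routeMass w {p | g p ∈ s} = ∑ k ∈ s, routeMass w {p | g p = k} := by
  classical
  simp only [routeMass, Finset.sum_filter, Set.mem_ofPred_eq]
  rw [Finset.sum_comm]
  refine Finset.sum_congr rfl fun p _ => ?_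
  simp

/-- A balanced weight has a layering in its support. -/
theorem IsBalanced.exists_isLayering [Finite V] [Fintype G.Route] {x : ℝ} {w : G.Route → ℝ}
    (hw : IsBalanced a x w) (hx : 0 < x) :
    ∃ L : Finset G.Route, G.IsLayering a L ∧ ∀ p ∈ L, w p ≠ 0 := by
  classical
  have := Fintype.ofFinite V
  let src : G.Route → {i // G.IsSource i} := fun p => ⟨p.src, p.isSource⟩
  let snk : G.Route → {j // G.IsSink j} := fun p => ⟨p.snk, p.isSink⟩
  have hsrc : ∀ i : {i // G.IsSource i}, routeMass w {p | src p = i} = x := fun i => by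
    rw [← hw.source i i.2]
    exact routeMass_congr fun p _ => Subtype.ext_iff
  have hsnk : ∀ j : {j // G.IsSink j}, routeMass w {p | snk p = j} = x * (a j).natAbs := fun j => by
    rw [← hw.sink j j.2]
    exact routeMass_congr fun p _ => Subtype.ext_iff
  have hsrcs : ∀ s : Finset {i // G.IsSource i}, routeMass w {p | src p ∈ s} = x * s.card := fun s => by
    simp [routeMass_fiber, hsrc, mul_comm]
  have hsnks : ∀ s : Finset {j // G.IsSink j}, routeMass w {p | snk p ∈ s} =
      x * (s.sigma fun j => (Finset.univ : Finset (Fin (a j).natAbs))).card := fun s => by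
    simp [routeMass_fiber, hsnk, Finset.mul_sum]
  -- Each sink `j` is split into `|a j|` slots; a source may use any slot of a sink that some route
  -- of nonzero weight joins it to.
  let t : {i // G.IsSource i} → Finset (Σ j : {j // G.IsSink j}, Fin (a j).natAbs) := fun i =>
    (Finset.univ.filter fun j => ∃ p, src p = i ∧ snk p = j ∧ w p ≠ 0).sigma
      fun j => (Finset.univ : Finset (Fin (a j).natAbs))
  have hall : ∀ s : Finset {i // G.IsSource i}, s.card ≤ (s.biUnion t).card := by
    intro s
    let N : Finset {j // G.IsSink j} := Finset.univ.filter fun j => ∃ p, src p ∈ s ∧ snk p = j ∧ w p ≠ 0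
    have hN : s.biUnion t = N.sigma fun j => (Finset.univ : Finset (Fin (a j).natAbs)) := by
      ext y
      simp only [t, N, Finset.mem_biUnion, Finset.mem_sigma, Finset.mem_filter, Finset.mem_univ,
        true_and, and_true]
      constructor
      · rintro ⟨i, hi, p, hp, h⟩
        exact ⟨p, hp ▸ hi, h⟩
      · rintro ⟨p, hp, h⟩
        exact ⟨_, hp, p, rfl, h⟩
    -- Hall's condition: the mass `x * |s|` leaving `s` ends in `N`, whose total mass is `x` times
    -- its number of slots.
    have hle : routeMass w {p | src p ∈ s} ≤ routeMass w {p | snk p ∈ N} := by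
      have h1 : routeMass w {p | src p ∈ s} =
          routeMass w ({p | src p ∈ s} ∩ {p | snk p ∈ N}) :=
        routeMass_congr fun p hp =>
          ⟨fun h => ⟨h, Finset.mem_filter.2 ⟨Finset.mem_univ _, p, h, rfl, hp⟩⟩, fun h => h.1⟩
      rw [h1]
      exact routeMass_mono hw.nonneg Set.inter_subset_right
    rw [hsrcs, hsnks, ← hN] at hle
    exact_mod_cast le_of_mul_le_mul_left hle hx
  obtain ⟨f, hf, hft⟩ := (Finset.all_card_le_biUnion_card_iff_exists_injective t).1 hall
  -- Counting the total mass at sources and at sinks shows that there are as many slots as sources,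
  -- so the matching fills every slot and each sink receives exactly `|a j|` routes.
  have hcard : Fintype.card {i // G.IsSource i} =
      Fintype.card (Σ j : {j // G.IsSink j}, Fin (a j).natAbs) := by
    have h1 := hsrcs Finset.univ
    have h2 := hsnks Finset.univ
    simp only [Finset.mem_univ, Set.ofPred_true, Finset.univ_sigma_univ] at h1 h2
    rw [h1] at h2
    exact_mod_cast mul_left_cancel₀ hx.ne' h2
  have hbij : Function.Bijective f := (Fintype.bijective_iff_injective_and_card f).2 ⟨hf, hcard⟩
  have hP : ∀ i, ∃ p, src p = i ∧ snk p = (f i).1 ∧ w p ≠ 0 := fun i => by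
    have := hft i
    simp only [t, Finset.mem_sigma, Finset.mem_filter, Finset.mem_univ, true_and, and_true] at this
    exact this
  choose P hPsrc hPsnk hPw using hP
  have hPinj : Function.Injective P := fun i i' h => by rw [← hPsrc i, h, hPsrc]
  refine ⟨Finset.univ.image P, ⟨fun i hi => ?_, fun j hj => ?_⟩, ?_⟩
  · rw [Finset.card_eq_one]
    refine ⟨P ⟨i, hi⟩, ?_⟩
    ext p
    simp only [Finset.mem_filter, Finset.mem_image, Finset.mem_univ, true_and,
      Finset.mem_singleton]
    constructor
    · rintro ⟨⟨i', rfl⟩, h⟩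
      congr 1
      rw [← hPsrc i']
      exact Subtype.ext h
    · rintro rfl
      exact ⟨⟨_, rfl⟩, congrArg Subtype.val (hPsrc ⟨i, hi⟩)⟩
  · have h1 : (Finset.univ.image P).filter (fun p => p.snk = j) =
        (Finset.univ.filter fun i => (f i).1 = ⟨j, hj⟩).image P := by
      ext p
      simp only [Finset.mem_filter, Finset.mem_image, Finset.mem_univ, true_and]
      constructor
      · rintro ⟨⟨i, rfl⟩, h⟩
        exact ⟨i, by rw [← hPsnk i]; exact Subtype.ext h, rfl⟩
      · rintro ⟨i, h, rfl⟩
        exact ⟨⟨i, rfl⟩, congrArg Subtype.val ((hPsnk i).trans h)⟩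
    have h2 : (Finset.univ.filter fun i => (f i).1 = ⟨j, hj⟩).image f =
        Finset.univ.image (Sigma.mk (β := fun j : {j // G.IsSink j} => Fin (a j).natAbs) ⟨j, hj⟩) := by
      ext y
      simp only [Finset.mem_filter, Finset.mem_image, Finset.mem_univ, true_and]
      constructor
      · rintro ⟨i, h, rfl⟩
        generalize f i = y at h
        obtain ⟨k, z⟩ := y
        subst h
        exact ⟨z, rfl⟩
      · rintro ⟨z, rfl⟩
        obtain ⟨i, hi⟩ := hbij.2 ⟨⟨j, hj⟩, z⟩
        exact ⟨i, by rw [hi], hi⟩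
    rw [h1, Finset.card_image_of_injective _ hPinj, ← Finset.card_image_of_injective _ hf, h2,
      Finset.card_image_of_injective _ sigma_mk_injective]
    simp
  · intro p hp
    obtain ⟨i, -, rfl⟩ := Finset.mem_image.1 hp
    exact hPw i

open Classical in
theorem IsBalanced.sub_layering [Fintype G.Route] {x c : ℝ} {w : G.Route → ℝ}
    (hw : IsBalanced a x w) {L : Finset G.Route} (hL : G.IsLayering a L)
    (hc : ∀ p ∈ L, c ≤ w p) :
    IsBalanced a (x - c) fun p => w p - if p ∈ L then c else 0 := by
  have key : ∀ A : Set G.Route, routeMass (fun p => w p - if p ∈ L then c else 0) A =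
      routeMass w A - c * (L.filter fun p => p ∈ A).card := by
    intro A
    rw [routeMass, routeMass, Finset.sum_sub_distrib, ← Finset.sum_filter, Finset.sum_const,
      nsmul_eq_mul, mul_comm, Finset.filter_filter]
    congr 4
    ext p
    simp [and_comm]
  refine ⟨fun p => ?_, fun i hi => ?_, fun j hj => ?_⟩
  · by_cases h : p ∈ L
    · simp [h, hc p h]
    · simp [h, hw.nonneg p]
  · rw [key, hw.source i hi]
    have := hL.source i hi
    simp only [Set.mem_ofPred_eq, this]
    simp
  · rw [key, hw.sink j hj]
    have h1 := hL.sink j hj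
    rw [Int.abs_eq_natAbs] at h1
    have h2 : (L.filter fun p => p.snk = j).card = (a j).natAbs := by exact_mod_cast h1
    simp only [Set.mem_ofPred_eq, h2]
    ring

/-! ### From balanced weights to a layering-simplex, and uniqueness -/

namespace Framing

variable {𝓕 : G.Framing}

open Classical in
/-- The weight of a route in a combination of layerings. -/
noncomputable def routeCoeff (𝓛 : Finset (Finset G.Route)) (c : Finset G.Route → ℝ)
    (p : G.Route) : ℝ :=
  ∑ L ∈ 𝓛 with p ∈ L, c L

theorem routeCoeff_nonneg {𝓛 : Finset (Finset G.Route)} {c : Finset G.Route → ℝ}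
    (hc : ∀ L ∈ 𝓛, 0 < c L) (p : G.Route) : 0 ≤ routeCoeff 𝓛 c p := by
  classical
  exact Finset.sum_nonneg fun _ hL => (hc _ (Finset.mem_filter.1 hL).1).le

theorem le_routeCoeff {𝓛 : Finset (Finset G.Route)} {c : Finset G.Route → ℝ}
    (hc : ∀ L ∈ 𝓛, 0 < c L) {L : Finset G.Route} (hL : L ∈ 𝓛) {p : G.Route} (hp : p ∈ L) :
    c L ≤ routeCoeff 𝓛 c p := by
  classical
  exact Finset.single_le_sum (f := c) (s := 𝓛.filter fun L => p ∈ L)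
    (fun K hK => (hc K (Finset.mem_of_mem_filter _ hK)).le) (Finset.mem_filter.2 ⟨hL, hp⟩)

theorem mem_routesOf_iff {𝓛 : Finset (Finset G.Route)} {c : Finset G.Route → ℝ}
    (hc : ∀ L ∈ 𝓛, 0 < c L) (p : G.Route) :
    p ∈ routesOf (𝓛 : Set (Finset G.Route)) ↔ routeCoeff 𝓛 c p ≠ 0 := by
  classical
  constructor
  · rintro ⟨L, hL, hp⟩
    exact ((hc L hL).trans_le (le_routeCoeff hc hL hp)).ne'
  · intro h
    obtain ⟨L, hL, -⟩ := Finset.exists_ne_zero_of_sum_ne_zero h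
    obtain ⟨hL, hp⟩ := Finset.mem_filter.1 hL
    exact ⟨L, hL, hp⟩

open Classical in
theorem routeCoeff_insert {𝓛 : Finset (Finset G.Route)} {c : Finset G.Route → ℝ}
    {L : Finset G.Route} (hL : L ∉ 𝓛) (p : G.Route) :
    routeCoeff (insert L 𝓛) c p = (if p ∈ L then c L else 0) + routeCoeff 𝓛 c p := by
  simp only [routeCoeff, Finset.sum_filter]
  rw [Finset.sum_insert hL]

theorem sum_smul_layeringIndicator [Fintype G.Route] (𝓛 : Finset (Finset G.Route))
    (c : Finset G.Route → ℝ) :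
    ∑ L ∈ 𝓛, c L • layeringIndicator L = ∑ p : G.Route, routeCoeff 𝓛 c p • p.indicator := by
  classical
  simp only [routeCoeff, layeringIndicator, Finset.sum_smul, Finset.smul_sum, Finset.sum_filter]
  rw [Finset.sum_comm' (t' := Finset.univ) (s' := fun p => 𝓛.filter fun L => p ∈ L)]
  · simp [Finset.sum_filter, ite_smul]
  · simp [and_comm]

-- The last two simplex conditions at `K` only see members at or above `K`. Adding or removing a
-- layering that is not above `K` therefore does not affect them.
open Classical in
theorem setOf_layeringLt_insert {𝓛 : Finset (Finset G.Route)} {L K : Finset G.Route}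
    (h : ¬ 𝓕.LayeringLt K L) :
    {K' | K' ∈ insert L 𝓛 ∧ 𝓕.LayeringLt K K'} = {K' | K' ∈ 𝓛 ∧ 𝓕.LayeringLt K K'} := by
  ext K'
  simp only [Finset.mem_insert, Set.mem_ofPred_eq]
  constructor
  · rintro ⟨rfl | hK', hlt⟩
    exacts [absurd hlt h, ⟨hK', hlt⟩]
  · exact fun ⟨hK', hlt⟩ => ⟨Or.inr hK', hlt⟩

open Classical in
theorem setOf_eq_or_layeringLt_insert {𝓛 : Finset (Finset G.Route)} {L K : Finset G.Route}
    (hne : L ≠ K) (h : ¬ 𝓕.LayeringLt K L) :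
    {K' | K' ∈ insert L 𝓛 ∧ (K' = K ∨ 𝓕.LayeringLt K K')} =
      {K' | K' ∈ 𝓛 ∧ (K' = K ∨ 𝓕.LayeringLt K K')} := by
  ext K'
  simp only [Finset.mem_insert, Set.mem_ofPred_eq]
  constructor
  · rintro ⟨rfl | hK', hlt | hlt⟩
    exacts [absurd hlt hne, absurd hlt h, ⟨hK', Or.inl hlt⟩, ⟨hK', Or.inr hlt⟩]
  · exact fun ⟨hK', hlt⟩ => ⟨Or.inr hK', hlt⟩

/-- A balanced weight supported on a clique is a positive combination of a layering-simplex. -/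
theorem exists_layeringSimplex [Finite V] [Fintype G.Route] {x : ℝ} {w : G.Route → ℝ}
    (hw : IsBalanced a x w) (hR : 𝓕.IsRouteClique {p | w p ≠ 0}) :
    ∃ (𝓛 : Finset (Finset G.Route)) (c : Finset G.Route → ℝ),
      𝓕.IsLayeringSimplex a 𝓛 ∧ (∀ L ∈ 𝓛, 0 < c L) ∧ (∀ p, routeCoeff 𝓛 c p = w p) ∧
      ((∀ p, ∃ n : ℤ, w p = n) → ∀ L ∈ 𝓛, ∃ n : ℤ, c L = n) := by
  classical
  -- Induction on the size of the support; `x` varies because each subtraction lowers it.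
  induction hn : (Finset.univ.filter fun p => w p ≠ 0).card using Nat.strong_induction_on
    generalizing x w with
  | _ n ih =>
  by_cases hzero : ∀ p, w p = 0
  · refine ⟨∅, 0, ⟨by simp, ?_, by simp, by simp⟩, by simp, ?_, by simp⟩
    · rintro p ⟨L, hL, -⟩
      simp at hL
    · simp [routeCoeff, hzero]
  push Not at hzero
  obtain ⟨p₀, hp₀⟩ := hzero
  have hx : 0 < x := by
    rw [← hw.source p₀.src p₀.isSource]
    refine ((hw.nonneg p₀).lt_of_ne' hp₀).trans_le ?_
    exact Finset.single_le_sum (f := w) (fun p _ => hw.nonneg p) (by simp)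
  obtain ⟨L₀, hL₀, hL₀w⟩ := hw.exists_isLayering hx
  -- Minimality among all layerings in the support provides `isMin` for `L` and puts `L` below every
  -- layering extracted later.
  obtain ⟨L, hLS, hmin⟩ := exists_min_layering (𝓕 := 𝓕) (a := a)
    (S := Finset.univ.filter fun L => G.IsLayering a L ∧ ∀ p ∈ L, w p ≠ 0)
    (fun L hL => (Finset.mem_filter.1 hL).2.1) ⟨L₀, by simpa using ⟨hL₀, hL₀w⟩⟩
  obtain ⟨hL, hLw⟩ := (Finset.mem_filter.1 hLS).2
  obtain ⟨q, hq, -⟩ := hL.exists_mem_src p₀.isSource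
  -- The coefficient of `L` is its smallest weight `w m`. The route `m` then disappears from the
  -- support, which makes the induction progress and serves as the new route required by
  -- `exists_new`.
  obtain ⟨m, hm, hmle⟩ := L.exists_min_image w ⟨q, hq⟩
  have hm0 : 0 < w m := (hw.nonneg m).lt_of_ne' (hLw m hm)
  set w' : G.Route → ℝ := fun p => w p - if p ∈ L then w m else 0 with hw'
  have hbal : IsBalanced a (x - w m) w' := hw.sub_layering hL hmle
  have hw'm : w' m = 0 := by simp [hw', hm]
  have hsupp : ∀ p, w' p ≠ 0 → w p ≠ 0 := by
    intro p hp h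
    by_cases hpL : p ∈ L
    · exact hLw p hpL h
    · exact hp (by simp [hw', hpL, h])
  have hlt : (Finset.univ.filter fun p => w' p ≠ 0).card < n := by
    rw [← hn]
    refine Finset.card_lt_card ((Finset.ssubset_iff_of_subset fun p hp => ?_).2 ⟨m, ?_, ?_⟩)
    · simpa using hsupp p (by simpa using hp)
    · simpa using hm0.ne'
    · simp [hw'm]
  obtain ⟨𝓛, c, hsimp, hpos, hcoeff, hinn⟩ := ih _ hlt hbal (hR.mono hsupp) rfl
  have hKw' : ∀ K ∈ 𝓛, ∀ p ∈ K, w' p ≠ 0 := fun K hK p hp => by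
    rw [← hcoeff p, ← mem_routesOf_iff hpos]
    exact ⟨K, hK, hp⟩
  have hL𝓛 : L ∉ 𝓛 := fun h => hKw' L h m hm hw'm
  have hLlt : ∀ K ∈ 𝓛, 𝓕.LayeringLt L K := fun K hK =>
    (hmin K (by simpa using ⟨hsimp.isLayering K hK, fun p hp => hsupp p (hKw' K hK p hp)⟩)
      ).resolve_left (by rintro rfl; exact hL𝓛 hK)
  have hnlt : ∀ K ∈ 𝓛, ¬ 𝓕.LayeringLt K L := fun K hK =>
    layeringLt_asymm hL (hsimp.isLayering K hK) (hLlt K hK)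
  let c' : Finset G.Route → ℝ := fun K => if K = L then w m else c K
  have hc'L : c' L = w m := by simp [c']
  have hc'K : ∀ K ∈ 𝓛, c' K = c K := fun K hK =>
    if_neg (by rintro rfl; exact hL𝓛 hK)
  have hpos' : ∀ K ∈ insert L 𝓛, 0 < c' K := by
    intro K hK
    rcases Finset.mem_insert.1 hK with rfl | hK
    · rwa [hc'L]
    · rw [hc'K K hK]
      exact hpos K hK
  have hcoeff' : ∀ p, routeCoeff (insert L 𝓛) c' p = w p := by
    intro p
    have : routeCoeff 𝓛 c' p = routeCoeff 𝓛 c p :=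
      Finset.sum_congr rfl fun K hK => hc'K K (Finset.mem_of_mem_filter _ hK)
    rw [routeCoeff_insert hL𝓛, hc'L, this, hcoeff]
    simp [hw']
  have hroutes : ∀ p ∈ routesOf ((insert L 𝓛 : Finset (Finset G.Route)) : Set (Finset G.Route)),
      w p ≠ 0 := fun p hp => by
    rw [← hcoeff' p]
    exact (mem_routesOf_iff hpos' p).1 hp
  refine ⟨insert L 𝓛, c', ⟨?_, hR.mono hroutes, ?_, ?_⟩, hpos', hcoeff', ?_⟩
  · intro K hK
    rcases Finset.mem_insert.1 hK with rfl | hK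
    exacts [hL, hsimp.isLayering K hK]
  · intro K hK M hM hsub
    rcases Finset.mem_insert.1 hK with rfl | hK
    · refine hmin M (by
        simp only [Finset.mem_filter, Finset.mem_univ, true_and]
        refine ⟨hM, fun p hp => ?_⟩
        obtain ⟨K', hK', hp⟩ := hsub hp
        exact hroutes p ⟨K', hK'.1, hp⟩)
    · rw [setOf_eq_or_layeringLt_insert (by rintro rfl; exact hL𝓛 hK) (hnlt K hK)] at hsub
      exact hsimp.isMin K hK M hM hsub
  · intro K hK
    rcases Finset.mem_insert.1 hK with rfl | hK
    · refine ⟨m, hm, ?_⟩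
      rintro ⟨K', ⟨hK', hlt⟩, hmK'⟩
      rcases Finset.mem_insert.1 hK' with rfl | hK'
      · exact layeringLt_irrefl hL hlt
      · exact hKw' K' hK' m hmK' hw'm
    · rw [setOf_layeringLt_insert (hnlt K hK)]
      exact hsimp.exists_new K hK
  · intro hwint K hK
    rcases Finset.mem_insert.1 hK with rfl | hK
    · rw [hc'L]
      exact hwint m
    · rw [hc'K K hK]
      refine hinn (fun p => ?_) K hK
      obtain ⟨k, hk⟩ := hwint p
      obtain ⟨l, hl⟩ := hwint m
      by_cases hpL : p ∈ L
      · exact ⟨k - l, by simp [hw', hpL, hk, hl]⟩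
      · exact ⟨k, by simp [hw', hpL, hk]⟩

/-- Removing the least layering preserves a simplex, which permits induction on the number of
layerings in the uniqueness proof. -/
theorem IsLayeringSimplex.of_insert [DecidableEq (Finset G.Route)]
    {𝓛 : Finset (Finset G.Route)} {L : Finset G.Route}
    (h : 𝓕.IsLayeringSimplex a (insert L 𝓛)) (hL : L ∉ 𝓛)
    (hlt : ∀ K ∈ 𝓛, 𝓕.LayeringLt L K) : 𝓕.IsLayeringSimplex a 𝓛 := by
  classical
  have hnlt : ∀ K ∈ 𝓛, ¬ 𝓕.LayeringLt K L := fun K hK =>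
    layeringLt_asymm (h.isLayering L (Finset.mem_insert_self _ _))
      (h.isLayering K (Finset.mem_insert_of_mem hK)) (hlt K hK)
  refine ⟨fun K hK => h.isLayering K (Finset.mem_insert_of_mem hK), h.clique.mono ?_, ?_, ?_⟩
  · rintro p ⟨K, hK, hp⟩
    exact ⟨K, Finset.mem_insert_of_mem hK, hp⟩
  · intro K hK M hM hsub
    refine h.isMin K (Finset.mem_insert_of_mem hK) M hM ?_
    convert hsub using 2
    convert setOf_eq_or_layeringLt_insert (by rintro rfl; exact hL hK) (hnlt K hK)
  · intro K hK
    have := h.exists_new K (Finset.mem_insert_of_mem hK)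
    convert this using 6
    convert (setOf_layeringLt_insert (hnlt K hK)).symm

theorem IsLayeringSimplex.eq_empty_of_routeCoeff_eq_zero {𝓛 : Finset (Finset G.Route)}
    {c : Finset G.Route → ℝ} (h : 𝓕.IsLayeringSimplex a 𝓛) (hc : ∀ L ∈ 𝓛, 0 < c L)
    (h0 : ∀ p, routeCoeff 𝓛 c p = 0) : 𝓛 = ∅ := by
  refine Finset.eq_empty_of_forall_notMem fun L hL => ?_
  obtain ⟨p, hp, -⟩ := h.exists_new L hL
  exact (mem_routesOf_iff hc p).1 ⟨L, hL, hp⟩ (h0 p)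

/-- The least layering of a simplex is least among all layerings with routes in the simplex. -/
theorem IsLayeringSimplex.min_le {𝓛 : Finset (Finset G.Route)} {L M : Finset G.Route}
    (h : 𝓕.IsLayeringSimplex a 𝓛) (hL : L ∈ 𝓛) (hmin : ∀ K ∈ 𝓛, L = K ∨ 𝓕.LayeringLt L K)
    (hM : G.IsLayering a M) (hsub : ∀ p ∈ M, p ∈ routesOf (𝓛 : Set (Finset G.Route))) :
    L = M ∨ 𝓕.LayeringLt L M := by
  refine h.isMin L hL M hM fun p hp => ?_
  obtain ⟨K, hK, hpK⟩ := hsub p hp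
  exact ⟨K, ⟨hK, (hmin K hK).imp_left Eq.symm⟩, hpK⟩

/-- The coefficient of the least layering of a simplex is the weight of some route. -/
theorem IsLayeringSimplex.exists_routeCoeff_eq {𝓛 : Finset (Finset G.Route)}
    {L : Finset G.Route} (h : 𝓕.IsLayeringSimplex a 𝓛) (hL : L ∈ 𝓛)
    (hmin : ∀ K ∈ 𝓛, L = K ∨ 𝓕.LayeringLt L K) (c : Finset G.Route → ℝ) :
    ∃ p ∈ L, routeCoeff 𝓛 c p = c L := by
  classical
  obtain ⟨p, hp, hnew⟩ := h.exists_new L hL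
  refine ⟨p, hp, ?_⟩
  have : 𝓛.filter (fun K => p ∈ K) = {L} := by
    ext K
    simp only [Finset.mem_filter, Finset.mem_singleton]
    constructor
    · rintro ⟨hK, hpK⟩
      exact ((hmin K hK).resolve_right fun hlt => hnew ⟨K, ⟨hK, hlt⟩, hpK⟩).symm
    · rintro rfl
      exact ⟨hL, hp⟩
  rw [routeCoeff]
  convert Finset.sum_singleton c L

/-- A layering-simplex and its positive coefficients are determined by the weights of the
routes. -/
theorem layeringSimplex_unique [Finite V] {𝓛₁ 𝓛₂ : Finset (Finset G.Route)}
    {c₁ c₂ : Finset G.Route → ℝ} (h₁ : 𝓕.IsLayeringSimplex a 𝓛₁)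
    (h₂ : 𝓕.IsLayeringSimplex a 𝓛₂) (hc₁ : ∀ L ∈ 𝓛₁, 0 < c₁ L) (hc₂ : ∀ L ∈ 𝓛₂, 0 < c₂ L)
    (h : ∀ p, routeCoeff 𝓛₁ c₁ p = routeCoeff 𝓛₂ c₂ p) :
    𝓛₁ = 𝓛₂ ∧ ∀ L ∈ 𝓛₁, c₁ L = c₂ L := by
  classical
  induction hn : 𝓛₁.card generalizing 𝓛₁ 𝓛₂ with
  | zero =>
    obtain rfl := Finset.card_eq_zero.1 hn
    refine ⟨(h₂.eq_empty_of_routeCoeff_eq_zero hc₂ fun p => ?_).symm, by simp⟩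
    rw [← h p]
    simp [routeCoeff]
  | succ n ih =>
    have hne₁ : 𝓛₁.Nonempty := Finset.card_pos.1 (by omega)
    have hne₂ : 𝓛₂.Nonempty := by
      refine Finset.nonempty_iff_ne_empty.2 fun h' => hne₁.ne_empty ?_
      refine h₁.eq_empty_of_routeCoeff_eq_zero hc₁ fun p => ?_
      rw [h p, h']
      simp [routeCoeff]
    have hroutes : routesOf (𝓛₁ : Set (Finset G.Route)) = routesOf (𝓛₂ : Set _) := by
      ext p
      rw [mem_routesOf_iff hc₁, mem_routesOf_iff hc₂, h]
    obtain ⟨L, hL₁, hmin₁⟩ := exists_min_layering (𝓕 := 𝓕) h₁.isLayering hne₁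
    obtain ⟨L', hL₂, hmin₂⟩ := exists_min_layering (𝓕 := 𝓕) h₂.isLayering hne₂
    -- Both simplices use the same routes, and each least layering is least among all layerings with
    -- these routes.
    obtain rfl : L = L' := by
      rcases h₁.min_le hL₁ hmin₁ (h₂.isLayering L' hL₂)
        (fun p hp => hroutes ▸ ⟨L', hL₂, hp⟩) with h | hlt
      · exact h
      · rcases h₂.min_le hL₂ hmin₂ (h₁.isLayering L hL₁)
          (fun p hp => hroutes ▸ ⟨L, hL₁, hp⟩) with h | hlt'
        · exact h.symm
        · exact absurd hlt' (layeringLt_asymm (h₁.isLayering L hL₁) (h₂.isLayering L' hL₂) hlt)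
    -- In either simplex the coefficient of `L` is at most the weight of each route of `L`, and
    -- equals the weight of one of them; so both coefficients are the minimum weight on `L`.
    have hcL : c₁ L = c₂ L := by
      obtain ⟨p, hp, hpc⟩ := h₁.exists_routeCoeff_eq hL₁ hmin₁ c₁
      obtain ⟨q, hq, hqc⟩ := h₂.exists_routeCoeff_eq hL₂ hmin₂ c₂
      refine le_antisymm ?_ ?_
      · rw [← hqc, ← h q]
        exact le_routeCoeff hc₁ hL₁ hq
      · rw [← hpc, h p]
        exact le_routeCoeff hc₂ hL₂ hp
    obtain ⟨𝓜₁, hLM₁, rfl⟩ : ∃ 𝓜, L ∉ 𝓜 ∧ insert L 𝓜 = 𝓛₁ :=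
      ⟨𝓛₁.erase L, Finset.notMem_erase _ _, Finset.insert_erase hL₁⟩
    obtain ⟨𝓜₂, hLM₂, rfl⟩ : ∃ 𝓜, L ∉ 𝓜 ∧ insert L 𝓜 = 𝓛₂ :=
      ⟨𝓛₂.erase L, Finset.notMem_erase _ _, Finset.insert_erase hL₂⟩
    have hlt₁ : ∀ K ∈ 𝓜₁, 𝓕.LayeringLt L K := fun K hK =>
      (hmin₁ K (Finset.mem_insert_of_mem hK)).resolve_left fun h => hLM₁ (h ▸ hK)
    have hlt₂ : ∀ K ∈ 𝓜₂, 𝓕.LayeringLt L K := fun K hK =>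
      (hmin₂ K (Finset.mem_insert_of_mem hK)).resolve_left fun h => hLM₂ (h ▸ hK)
    obtain ⟨rfl, hc⟩ := ih (h₁.of_insert hLM₁ hlt₁) (h₂.of_insert hLM₂ hlt₂)
      (fun K hK => hc₁ K (Finset.mem_insert_of_mem hK))
      (fun K hK => hc₂ K (Finset.mem_insert_of_mem hK))
      (fun p => by
        have := h p
        rw [routeCoeff_insert hLM₁, routeCoeff_insert hLM₂, hcL] at this
        exact add_left_cancel this)
      (by rw [Finset.card_insert_of_notMem hLM₁] at hn; omega)
    refine ⟨rfl, fun K hK => ?_⟩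
    rcases Finset.mem_insert.1 hK with rfl | hK
    exacts [hcL, hc K hK]

end Framing

/-! ### Balance of the route weights of a flow -/

/-- The route weights of a decomposition of a conservationist flow are balanced. -/
theorem IsFlow.isBalanced [Fintype E] [DecidableEq V] [Fintype G.Route] (hG : G.IsAcyclic)
    (ha : G.IsConservationist a) {x : ℝ} {F : E → ℝ}
    (hF : G.IsFlow (fun v => x * (a v : ℝ)) F) {w : G.Route → ℝ} (hw : ∀ p, 0 ≤ w p)
    (h : ∑ p : G.Route, w p • p.indicator = F) : IsBalanced a x w := by
  have hmass : ∀ e, routeMass w {p | e ∈ p.edges} = F e := fun e => by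
    rw [← sum_smul_indicator_apply, h]
  refine ⟨hw, fun i hi => ?_, fun j hj => ?_⟩
  · have h1 := routeMass_exists_mem (w := w) (Finset.univ.filter fun e => G.tail e = i) (by
      intro p e he f hf hep hfp
      simp only [Finset.mem_filter, Finset.mem_univ, true_and] at he hf
      exact p.eq_of_tail_eq hG hep hfp (he.trans hf.symm))
    -- No edge enters a source, so the netflow condition says that the edges leaving it carry `x` in
    -- total; each route starting there uses exactly one of them.
    have h2 : _ = x * (a i : ℝ) := hF.2 i
    rw [Finset.filter_false_of_mem (p := fun e => G.head e = i) fun e _ => hi e, Finset.sum_empty,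
      ha.source i hi, sub_zero, Int.cast_one, mul_one] at h2
    simp only [hmass, h2] at h1
    rw [← h1]
    refine routeMass_congr fun p _ => ?_
    simp only [Set.mem_ofPred_eq, Finset.mem_filter, Finset.mem_univ, true_and]
    have hpp := p.isPath
    constructor
    · rintro rfl
      obtain ⟨e, l, hl⟩ := List.exists_cons_of_ne_nil (p.edges_ne_nil ha)
      rw [hl] at hpp
      exact ⟨e, (isPath_cons_iff.1 hpp).1, by simp [hl]⟩
    · rintro ⟨e, rfl, he⟩
      obtain ⟨l₁, l₂, -, h1, -⟩ := p.exists_split_at he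
      obtain rfl := hi.eq_nil_of_isPath h1
      exact isPath_nil_iff.1 h1
  · have h1 := routeMass_exists_mem (w := w) (Finset.univ.filter fun e => G.head e = j) (by
      intro p e he f hf hep hfp
      simp only [Finset.mem_filter, Finset.mem_univ, true_and] at he hf
      exact p.eq_of_head_eq hG hep hfp (he.trans hf.symm))
    have h2 : _ = x * (a j : ℝ) := hF.2 j
    rw [Finset.filter_false_of_mem (p := fun e => G.tail e = j) fun e _ => hj e, Finset.sum_empty,
      zero_sub, neg_eq_iff_eq_neg] at h2
    have h3 : ((a j).natAbs : ℝ) = -(a j : ℝ) := by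
      have := ha.sink j hj
      rw [Nat.cast_natAbs, abs_of_neg this, Int.cast_neg]
    simp only [hmass, h2] at h1
    rw [h3, mul_neg, ← h1]
    refine routeMass_congr fun p _ => ?_
    simp only [Set.mem_ofPred_eq, Finset.mem_filter, Finset.mem_univ, true_and]
    have hpp := p.isPath
    constructor
    · rintro rfl
      obtain ⟨l, e, hl⟩ := (List.eq_nil_or_concat p.edges).resolve_left (p.edges_ne_nil ha)
      rw [hl, List.concat_eq_append] at hpp
      exact ⟨e, (isPath_snoc_iff.1 hpp).2, by simp [hl]⟩
    · rintro ⟨e, rfl, he⟩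
      obtain ⟨l₁, l₂, -, -, h1⟩ := p.exists_split_at he
      obtain rfl := hj.eq_nil_of_isPath h1
      exact (isPath_nil_iff.1 h1).symm

end DiMultigraph

/-! ### The main theorem -/

theorem theorem3p12 {V E : Type*} [Fintype V] [DecidableEq V] [Fintype E]
    (G : DiMultigraph V E) (hG : G.IsAcyclic) (a : V → ℤ) (ha : G.IsConservationist a)
    (𝓕 : G.Framing) (x : ℝ) (hx : 0 < x) (F : E → ℝ)
    (hF : G.IsFlow (fun v => x * (a v : ℝ)) F) :
    ∃ (𝓛 : Finset (Finset G.Route)) (c : Finset G.Route → ℝ),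
      𝓕.IsPositiveCombination a F 𝓛 c ∧
      (∀ (𝓛' : Finset (Finset G.Route)) (c' : Finset G.Route → ℝ),
        𝓕.IsPositiveCombination a F 𝓛' c' → 𝓛' = 𝓛 ∧ ∀ L ∈ 𝓛, c' L = c L) ∧
      ((∀ e, ∃ n : ℤ, F e = n) → ∀ L ∈ 𝓛, ∃ n : ℤ, c L = n) := by
  have := DiMultigraph.Route.finite hG ha
  have := Fintype.ofFinite G.Route
  have h0 := hF.1
  have hsum : ∑ p : G.Route, 𝓕.pathWeight F p.edges • p.indicator = F := by
    refine DiMultigraph.Framing.sum_pathWeight_mul_indicator h0 (fun v hv => ?_) hG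
    have : _ = x * (a v : ℝ) := hF.2 v
    rw [ha.internal v hv, Int.cast_zero, mul_zero, sub_eq_zero] at this
    convert this
  have hbal := hF.isBalanced hG ha
    (fun p : G.Route => DiMultigraph.Framing.pathWeight_nonneg (𝓕 := 𝓕) h0 p.edges) hsum
  obtain ⟨𝓛, c, hsimp, hpos, hcoeff, hinn⟩ :=
    DiMultigraph.Framing.exists_layeringSimplex hbal (DiMultigraph.Framing.isRouteClique_support_pathWeight h0)
  refine ⟨𝓛, c, ⟨hsimp, hpos, ?_⟩, fun 𝓛' c' h' => ?_, fun hFint =>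
    hinn fun p => DiMultigraph.Framing.exists_int_pathWeight hFint p.edges⟩
  · rw [DiMultigraph.Framing.sum_smul_layeringIndicator]
    simp only [hcoeff]
    exact hsum.symm
  · have hF' := h'.eq_sum
    rw [DiMultigraph.Framing.sum_smul_layeringIndicator] at hF'
    -- The route weights of any competing combination are supported on its clique, hence equal the
    -- stacked weights; this reduces uniqueness to simplices with equal route weights.
    have hclique : 𝓕.IsRouteClique {p | DiMultigraph.Framing.routeCoeff 𝓛' c' p ≠ 0} :=
      h'.simplex.clique.mono fun p hp => (DiMultigraph.Framing.mem_routesOf_iff h'.pos p).2 hp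
    have heq : ∀ p, DiMultigraph.Framing.routeCoeff 𝓛' c' p = DiMultigraph.Framing.routeCoeff 𝓛 c p := fun p => by
      rw [hcoeff]
      exact DiMultigraph.Framing.eq_pathWeight_of_isRouteClique hG (DiMultigraph.Framing.routeCoeff_nonneg h'.pos) hclique
        hF'.symm p (p.edges_ne_nil ha)
    obtain ⟨rfl, hc⟩ := DiMultigraph.Framing.layeringSimplex_unique h'.simplex hsimp h'.pos hpos heq
    exact ⟨rfl, hc⟩
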